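/- All functions and distributions are complex valued and defined on $\mathbb R^n$; $\mathcal S$ is the Schwartz space and $\mathcal S'$ the space of tempered distributions. Let $\mathcal B$ be the space of smooth functions all of whose derivatives are bounded. Let $\dot{\mathcal B}\subset\mathcal B$ be the subspace of functions all of whose derivatives tend to $0$ at infinity, with the topology given by the seminorms $\sup|\partial^\beta\varphi|$. Let $\mathcal B_c$ be $\mathcal B$ with the finest locally convex topology that on every bounded subset of $\mathcal B$ induces the topology inherited from $C^\infty(\mathbb R^n)$. Let $\mathcal D'_{L^1}\subset\mathcal S'$ be the dual of $\dot{\mathcal B}$; each of its elements extends uniquely to a continuous linear form on $\mathcal B_c$, and $\langle u,1\rangle$ denotes the value of this extension of $u\in\mathcal D'_{L^1}$ at the constant function $1$. Let $\mathcal D_{L^1}$ be the space of smooth functions all of whose derivatives belong to $L^1$. Two tempered distributions $u,v$ are $\mathcal S'$-convolvable if $u(\check v*\varphi)\in\mathcal D'_{L^1}$ for every $\varphi\in\mathcal S$, where $(\check v*\varphi)(\eta)=\langle v,\varphi(\cdot+\eta)\rangle$; their $\mathcal S'$-convolution $u*v\in\mathcal S'$ is then defined by $\langle u*v,\varphi\rangle=\langle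 u(\check v*\varphi),1\rangle$ for $\varphi\in\mathcal S$. Let $\alpha>-1$ and $w_\alpha(x)=(1+|x|^2)^{(\alpha+n+1)/2}$, and put $$w_\alpha\mathcal D'_{L^1}=\{u\in\mathcal S':w_\alpha^{-1}u\in\mathcal D'_{L^1}\},\qquad w_\alpha\mathcal D_{L^1}=\{\varphi\in C^\infty:w_\alpha^{-1}\varphi\in\mathcal D_{L^1}\},$$ $$L^1(w_\alpha^{-1})=L^1(w_\alpha^{-1}(x)\,dx).$$ For $y>0$ let $$\mathcal K_{\alpha,y}(x)=\frac{\Gamma((\alpha+n+1)/2)}{\Gamma((\alpha+1)/2)\,\pi^{n/2}}\cdot\frac{y^{\alpha+1}}{(|x|^2+y^2)^{(\alpha+n+1)/2}},\qquad x\in\mathbb R^n.$$ Lemma. If $f\in w_\alpha\mathcal D'_{L^1}$, then for every $y>0$ the tempered distributions $\mathcal K_{\alpha,y}$ and $f$ are $\mathcal S'$-convolvable, and $\mathcal K_{\alpha,y}*f$ is (the distribution given by) a function in $w_\alpha\mathcal D_{L^1}$. In particular, the $\mathcal S'$-convolution with $\mathcal K_{\alpha,y}$ preserves $L^1(w_\alpha^{-1})$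 for each $y>0$: if $f\in L^1(w_\alpha^{-1})$, then $\mathcal K_{\alpha,y}$ and $f$ are $\mathcal S'$-convolvable and $\mathcal K_{\alpha,y}*f$ is given by a function in $L^1(w_\alpha^{-1})$. -/

import Mathlib

open MeasureTheory Filter Topology
open scoped SchwartzMap ContDiff BoundedContinuousFunction

noncomputable section

namespace GASP

/-- Euclidean space `ℝⁿ`. -/
abbrev Rn (n : ℕ) : Type := EuclideanSpace ℝ (Fin n)

/-! ### The spaces `𝓑`, `𝓑̇` and `𝓑_c` -/

/-- The space `𝓑` of smooth functions `ℝⁿ → ℂ` all of whose derivatives are bounded. -/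
def B (n : ℕ) : Submodule ℂ (Rn n → ℂ) where
  carrier := {φ | ContDiff ℝ ∞ φ ∧ ∀ k : ℕ, ∃ C : ℝ, ∀ x, ‖iteratedFDeriv ℝ k φ x‖ ≤ C}
  zero_mem' := by
    refine ⟨contDiff_const, fun k => ⟨0, fun x => ?_⟩⟩
    have h : (0 : Rn n → ℂ) = fun _ => 0 := rfl
    rw [h, iteratedFDeriv_fun_zero]
    simp
  add_mem' := by
    rintro f g ⟨hf, hf'⟩ ⟨hg, hg'⟩
    refine ⟨hf.add hg, fun k => ?_⟩
    obtain ⟨C, hC⟩ := hf' k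
    obtain ⟨D, hD⟩ := hg' k
    refine ⟨C + D, fun x => ?_⟩
    rw [iteratedFDeriv_add_apply (hf.of_le (by exact_mod_cast le_top)).contDiffAt
      (hg.of_le (by exact_mod_cast le_top)).contDiffAt]
    exact (norm_add_le _ _).trans (add_le_add (hC x) (hD x))
  smul_mem' := by
    rintro c f ⟨hf, hf'⟩
    refine ⟨hf.const_smul c, fun k => ?_⟩
    obtain ⟨C, hC⟩ := hf' k
    refine ⟨‖c‖ * C, fun x => ?_⟩
    rw [iteratedFDeriv_const_smul_apply (hf.of_le (by exact_mod_cast le_top)).contDiffAt,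
      norm_smul]
    exact mul_le_mul_of_nonneg_left (hC x) (norm_nonneg c)

variable {n : ℕ}

/-- The `k`-th total derivative `𝓑 → C_b`, as a linear map into the bounded continuous functions
with the supremum norm. -/
def B.deriv (k : ℕ) : B n →ₗ[ℂ] (Rn n →ᵇ (Rn n [×k]→L[ℝ] ℂ)) where
  toFun φ := BoundedContinuousFunction.ofNormedAddCommGroup (iteratedFDeriv ℝ k (φ : Rn n → ℂ))
    (φ.2.1.continuous_iteratedFDeriv (by exact_mod_cast le_top))
    (φ.2.2 k).choose (φ.2.2 k).choose_spec
  map_add' f g := by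
    ext1 x
    exact iteratedFDeriv_add_apply (f.2.1.of_le (by exact_mod_cast le_top)).contDiffAt
      (g.2.1.of_le (by exact_mod_cast le_top)).contDiffAt
  map_smul' c f := by
    ext1 x
    exact iteratedFDeriv_const_smul_apply (f.2.1.of_le (by exact_mod_cast le_top)).contDiffAt

@[simp] theorem B.deriv_apply (k : ℕ) (φ : B n) (x : Rn n) :
    B.deriv k φ x = iteratedFDeriv ℝ k (φ : Rn n → ℂ) x := rfl

/-- The subspace `𝓑̇` of `𝓑`: all derivatives tend to `0` at infinity. -/
def BDotSub (n : ℕ) : Submodule ℂ (B n) where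
  carrier := {φ | ∀ k : ℕ, Tendsto (B.deriv k φ) (cocompact (Rn n)) (𝓝 0)}
  zero_mem' := fun k => by
    rw [map_zero]
    exact tendsto_const_nhds
  add_mem' := fun {f g} hf hg k => by
    rw [map_add]
    have h := (hf k).add (hg k)
    rw [add_zero] at h
    exact h
  smul_mem' := fun c f hf k => by
    rw [map_smul]
    have h := (hf k).const_smul c
    have h0 : c • (0 : Rn n [×k]→L[ℝ] ℂ) = 0 := by
      ext
      simp
    exact h0 ▸ h

/-- The space `𝓑̇`, as a type of its own, to be given the topology of uniform convergence of all
derivatives. -/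
def BDot (n : ℕ) : Type := BDotSub n

instance : AddCommGroup (BDot n) := inferInstanceAs (AddCommGroup (BDotSub n))
instance : Module ℂ (BDot n) := inferInstanceAs (Module ℂ (BDotSub n))

/-- The inclusion `𝓑̇ ⊂ 𝓑`. -/
def BDot.toB : BDot n →ₗ[ℂ] B n := (BDotSub n).subtype

/-- The seminorms `φ ↦ sup |∂ᵏφ|` of `𝓑̇`. -/
def BDot.seminorms (n : ℕ) : SeminormFamily ℂ (BDot n) ℕ := fun k =>
  (normSeminorm ℂ (Rn n →ᵇ (Rn n [×k]→L[ℝ] ℂ))).comp (B.deriv k ∘ₗ BDot.toB)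

/-- The topology of `𝓑̇` is defined by the seminorms `φ ↦ sup |∂ᵏφ|`, `k = 0, 1, 2, …`. -/
instance : TopologicalSpace (BDot n) := (BDot.seminorms n).moduleFilterBasis.topology

/-- The space `𝓑_c`: it is `𝓑` as a vector space, as a type of its own, to be given another
topology. -/
def Bc (n : ℕ) : Type := B n

instance : AddCommGroup (Bc n) := inferInstanceAs (AddCommGroup (B n))
instance : Module ℂ (Bc n) := inferInstanceAs (Module ℂ (B n))
instance : Module ℝ (Bc n) := inferInstanceAs (Module ℝ (B n))

/-- The identity `𝓑 → 𝓑_c`. -/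
def B.toBc : B n →ₗ[ℂ] Bc n := LinearMap.id

/-- The bounded subsets of `𝓑`: every derivative is bounded uniformly on the set. -/
def B.IsBddSet (S : Set (B n)) : Prop :=
  ∀ k : ℕ, ∃ C : ℝ, ∀ φ ∈ S, ‖B.deriv k φ‖ ≤ C

/-- The topology that `𝓑` inherits from `C^∞(ℝⁿ)`: uniform convergence of every derivative on
compact sets. -/
@[reducible] def B.smoothTopology (n : ℕ) : TopologicalSpace (B n) :=
  ⨅ k : ℕ, TopologicalSpace.induced
    (fun φ : B n => (B.deriv k φ).toContinuousMap) ContinuousMap.compactOpen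

/-- The locally convex topologies on `𝓑` that induce, on every bounded subset of `𝓑`, the topology
inherited from `C^∞(ℝⁿ)`. -/
def Bc.admissible (n : ℕ) : Set (TopologicalSpace (Bc n)) :=
  {t | @IsTopologicalAddGroup (Bc n) t _ ∧ @ContinuousSMul ℂ (Bc n) _ _ t ∧
    @LocallyConvexSpace ℝ (Bc n) _ _ _ _ t ∧
    ∀ S : Set (B n), B.IsBddSet S →
      TopologicalSpace.induced (fun φ : S => B.toBc (φ : B n)) t =
        TopologicalSpace.induced (fun φ : S => (φ : B n)) (B.smoothTopology n)}

/-- The topology of `𝓑_c` is the finest locally convex topology that induces, on every bounded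
subset of `𝓑`, the topology inherited from `C^∞(ℝⁿ)`. (In the order on topologies used here
the finer topology is the smaller one; the infimum of the admissible topologies is itself
admissible.) -/
instance : TopologicalSpace (Bc n) := sInf (Bc.admissible n)

/-- The constant function `1` in `𝓑_c`. -/
def Bc.one (n : ℕ) : Bc n :=
  B.toBc ⟨fun _ => 1, contDiff_const, fun k => ⟨1, fun x => by
    rcases k with _ | k
    · simp
    · rw [iteratedFDeriv_const_of_ne (Nat.succ_ne_zero k)]
      simp⟩⟩

theorem schwartz_mem_B (φ : 𝓢(Rn n, ℂ)) : (φ : Rn n → ℂ) ∈ B n :=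
  ⟨φ.smooth ⊤, fun k => ⟨SchwartzMap.seminorm ℝ 0 k φ,
    fun x => SchwartzMap.norm_iteratedFDeriv_le_seminorm ℝ φ k x⟩⟩

theorem schwartz_mem_BDot (φ : 𝓢(Rn n, ℂ)) :
    (⟨φ, schwartz_mem_B φ⟩ : B n) ∈ BDotSub n := by
  intro k
  obtain ⟨C, hC⟩ := φ.decay 1 k
  have h1 : Tendsto (fun x : Rn n => C * ‖x‖⁻¹) (cocompact (Rn n)) (𝓝 0) := by
    simpa using (tendsto_inv_atTop_zero.comp (tendsto_norm_cocompact_atTop (E := Rn n))).const_mul C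
  refine squeeze_zero_norm' ?_ h1
  filter_upwards [(tendsto_norm_cocompact_atTop (E := Rn n)).eventually (eventually_gt_atTop 0)]
    with x hx
  have := hC.2 x
  rw [pow_one] at this
  rw [B.deriv_apply, ← div_eq_mul_inv, le_div_iff₀ hx, mul_comm]
  exact this

/-- The inclusion `𝓢 ⊂ 𝓑̇`. -/
def schwartzToBDot (φ : 𝓢(Rn n, ℂ)) : BDot n := ⟨⟨φ, schwartz_mem_B φ⟩, schwartz_mem_BDot φ⟩

/-! ### Integrable distributions and the weighted spaces -/

/-- The tempered distribution `u` is the restriction to `𝓢` of `T`, an element of the dual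
of `𝓑̇`. -/
def Restricts (T : BDot n →L[ℂ] ℂ) (u : 𝓢'(Rn n, ℂ)) : Prop :=
  ∀ φ : 𝓢(Rn n, ℂ), T (schwartzToBDot φ) = u φ

/-- `u ∈ 𝓓'_{L¹}`, where `𝓓'_{L¹}` is the dual of `𝓑̇`. -/
def MemDL1' (u : 𝓢'(Rn n, ℂ)) : Prop := ∃ T : BDot n →L[ℂ] ℂ, Restricts T u

/-- `u ∈ 𝓓'_{L¹}` and `⟨u, 1⟩ = c`, the duality pairing of `𝓓'_{L¹}` and `𝓑_c`: the continuous
linear form on `𝓑̇` defined by `u` is extended to a continuous linear form `U` on `𝓑_c`,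
and `c = U 1`. (As `𝓢` is dense in `𝓑̇` and in `𝓑_c`, there is at most one `T`, one `U`
and one `c`.) -/
def HasIntegral (u : 𝓢'(Rn n, ℂ)) (c : ℂ) : Prop :=
  ∃ T : BDot n →L[ℂ] ℂ, Restricts T u ∧
    ∃ U : Bc n →L[ℂ] ℂ, (∀ φ : BDot n, U (B.toBc (BDot.toB φ)) = T φ) ∧ U (Bc.one n) = c

/-- The function `w^μ`, where `w(x) = (1 + |x|²)^{1/2}`, with values in `ℂ`. -/
def wPow (μ : ℝ) (x : Rn n) : ℂ := ((((1 + ‖x‖ ^ 2) ^ (1 / 2 : ℝ)) ^ μ : ℝ) : ℂ)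

theorem wPow_hasTemperateGrowth (μ : ℝ) : (wPow μ : Rn n → ℂ).HasTemperateGrowth := by
  have h := Function.Complex.hasTemperateGrowth_ofReal.comp
    (Function.hasTemperateGrowth_one_add_norm_sq_rpow (Rn n) (1 / 2 * μ))
  have heq : (wPow μ : Rn n → ℂ) =
      Complex.ofReal ∘ fun x => (1 + ‖x‖ ^ 2) ^ (1 / 2 * μ) := by
    funext x
    simp only [wPow, Function.comp]
    rw [← Real.rpow_mul (by positivity)]
  rw [heq]
  exact h

/-- `u ∈ w^μ 𝓓'_{L¹}`, i.e. `w^{-μ} u ∈ 𝓓'_{L¹}`. -/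
def MemWeightedDL1' (μ : ℝ) (u : 𝓢'(Rn n, ℂ)) : Prop :=
  MemDL1' (TemperedDistribution.smulLeftCLM ℂ (wPow (-μ)) u)

/-- `φ ∈ 𝓓_{L¹}`: the function `φ` is smooth and all its derivatives are in `L¹`. -/
def MemDL1 (φ : Rn n → ℂ) : Prop :=
  ContDiff ℝ ∞ φ ∧ ∀ k : ℕ, Integrable (iteratedFDeriv ℝ k φ)

/-- `φ ∈ w^μ 𝓓_{L¹}`: the function `φ` is smooth and `w^{-μ} φ ∈ 𝓓_{L¹}`. -/
def MemWeightedDL1 (μ : ℝ) (φ : Rn n → ℂ) : Prop :=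
  ContDiff ℝ ∞ φ ∧ MemDL1 (fun x => wPow (-μ) x * φ x)

/-- `g ∈ L¹(w^{-μ}) = L¹(w^{-μ}(x) dx)`. -/
def MemWeightedL1 (μ : ℝ) (g : Rn n → ℂ) : Prop :=
  Integrable (fun x => wPow (-μ) x * g x)

theorem MemWeightedDL1.memWeightedL1 {μ : ℝ} {φ : Rn n → ℂ} (h : MemWeightedDL1 μ φ) :
    MemWeightedL1 μ φ := by
  have h0 := (h.2.2 0).norm
  simp only [norm_iteratedFDeriv_zero] at h0
  exact (integrable_norm_iff h.2.1.continuous.aestronglyMeasurable).1 h0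

/-- The tempered distribution `φ ↦ ∫ φ g` defined by a function `g ∈ L¹(w^{-μ})`, written as the
product of `w^μ` and the tempered distribution given by `w^{-μ} g ∈ L¹`. -/
def distOf {μ : ℝ} {g : Rn n → ℂ} (hg : MemWeightedL1 μ g) : 𝓢'(Rn n, ℂ) :=
  TemperedDistribution.smulLeftCLM ℂ (wPow μ)
    (Lp.toTemperedDistribution ((memLp_one_iff_integrable.2 hg).toLp _))

theorem distOf_apply {μ : ℝ} {g : Rn n → ℂ} (hg : MemWeightedL1 μ g) (φ : 𝓢(Rn n, ℂ)) :
    distOf hg φ = ∫ x, φ x * g x := by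
  rw [distOf, TemperedDistribution.smulLeftCLM_apply_apply, Lp.toTemperedDistribution_apply]
  refine integral_congr_ae ?_
  filter_upwards [(memLp_one_iff_integrable.2 hg).coeFn_toLp] with x hx
  rw [hx, SchwartzMap.smulLeftCLM_apply_apply (wPow_hasTemperateGrowth μ)]
  have h1 : wPow μ x * wPow (-μ) x = 1 := by
    simp only [wPow]
    rw [← Complex.ofReal_mul, ← Real.rpow_add (by positivity)]
    simp
  simp only [smul_eq_mul]
  linear_combination (φ x * g x) * h1

/-! ### The `𝓢'`-convolution -/

/-- The function `v̌ ∗ φ : η ↦ ⟨v, φ(· + η)⟩`, for `v ∈ 𝓢'` and `φ ∈ 𝓢`. -/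
def checkConv (v : 𝓢'(Rn n, ℂ)) (φ : 𝓢(Rn n, ℂ)) (η : Rn n) : ℂ :=
  v (SchwartzMap.compSubConstCLM ℂ (-η) φ)

/-- The multiplicative product `u (v̌ ∗ φ)` in `𝓢'`. (The function `v̌ ∗ φ` is smooth and it and
all its derivatives have at most polynomial growth, so that this is the usual product.) -/
def checkProd (u v : 𝓢'(Rn n, ℂ)) (φ : 𝓢(Rn n, ℂ)) : 𝓢'(Rn n, ℂ) :=
  TemperedDistribution.smulLeftCLM ℂ (checkConv v φ) u

/-- `u` and `v` are `𝓢'`-convolvable. -/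
def SConvolvable (u v : 𝓢'(Rn n, ℂ)) : Prop :=
  ∀ φ : 𝓢(Rn n, ℂ), MemDL1' (checkProd u v φ)

/-- `u` and `v` are `𝓢'`-convolvable and `h` is their `𝓢'`-convolution `u ∗ v`, that is,
`⟨h, φ⟩ = ⟨u (v̌ ∗ φ), 1⟩` for all `φ ∈ 𝓢`. -/
def IsSConv (u v h : 𝓢'(Rn n, ℂ)) : Prop :=
  SConvolvable u v ∧ ∀ φ : 𝓢(Rn n, ℂ), HasIntegral (checkProd u v φ) (h φ)

/-! ### The kernel -/

/-- The kernel `𝒦_{α,y}(x) = 𝒦_α(x,y)` on `ℝⁿ`. -/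
def kernel (α y : ℝ) (x : Rn n) : ℝ :=
  Real.Gamma ((α + n + 1) / 2) / (Real.Gamma ((α + 1) / 2) * Real.pi ^ ((n : ℝ) / 2)) *
    (y ^ (α + 1) / (‖x‖ ^ 2 + y ^ 2) ^ ((α + n + 1) / 2))

theorem kernel_hasTemperateGrowth (α : ℝ) {y : ℝ} (hy : 0 < y) :
    (fun x : Rn n => (kernel α y x : ℂ)).HasTemperateGrowth := by
  set s : ℝ := (α + n + 1) / 2 with hs
  set c : ℝ := Real.Gamma s / (Real.Gamma ((α + 1) / 2) * Real.pi ^ ((n : ℝ) / 2)) with hc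
  have h := (Function.Complex.hasTemperateGrowth_ofReal.comp
    ((Function.hasTemperateGrowth_one_add_norm_sq_rpow (Rn n) (-s)).comp
      ((y⁻¹ • ContinuousLinearMap.id ℝ (Rn n)).hasTemperateGrowth)))
  have h2 := (Function.HasTemperateGrowth.const (E := Rn n)
    ((c * (y ^ (α + 1) * (y ^ 2) ^ (-s)) : ℝ) : ℂ)).mul h
  refine (congrArg Function.HasTemperateGrowth ?_).mpr h2
  funext x
  have hx : ‖x‖ ^ 2 + y ^ 2 = y ^ 2 * (1 + ‖y⁻¹ • x‖ ^ 2) := by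
    rw [norm_smul, norm_inv, Real.norm_eq_abs, mul_pow, inv_pow, sq_abs]
    field_simp
    ring
  simp only [kernel, Pi.mul_apply, Function.comp, ← hs, ← hc]
  rw [← Complex.ofReal_mul, hx, Real.mul_rpow (by positivity) (by positivity), div_eq_mul_inv,
    mul_inv, ← Real.rpow_neg (by positivity), ← Real.rpow_neg (by positivity)]
  congr 1
  simp only [smul_apply, ContinuousLinearMap.id_apply]
  ring

/-- `𝒦_{α,y}`, for `y > 0`, as a tempered distribution. -/
def kernelDist (n : ℕ) (α : ℝ) {y : ℝ} (hy : 0 < y) : 𝓢'(Rn n, ℂ) :=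
  (kernel_hasTemperateGrowth α hy).toTemperedDistribution

end GASP

end

noncomputable section

namespace GASP
section

/-! ### Smooth functions whose derivatives are all dominated by one function -/

section Dominated

variable {E F : Type*} [NormedAddCommGroup E] [NormedSpace ℝ E]
  [NormedAddCommGroup F] [NormedSpace ℝ F]

/-! Put μ = α + n + 1 > n and w = (1 + |x|²)^{1/2}. The form `T` given by w^{-μ} f on 𝓑̇ is bounded
by finitely many derivatives, say of order at most m, and it is tight: its values on functions
supported far out are small (`BDot.tight`). Hence it extends to a form `U` on all of 𝓑 that is
approximated in norm by `U` composed with cutoffs (`BDot.exists_extension`).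

For κ whose derivatives are all O(w^{-μ}), set Φ(ξ, x) = w(ξ)^{-μ} w(x)^μ κ(ξ - x). Formally, U(Φ(ξ,
·)) is w(ξ)^{-μ} (f * κ)(ξ). By a Peetre inequality all derivatives of Φ are O(w(ξ - x)^{-μ} +
w(ξ)^{-μ}), and the integral of this bound over ξ is finite and independent of x. The supremum over
x is in general not controlled by an integrable function of ξ, but pointwise bounds suffice by
duality: ∫ |U(Φ(ξ, ·))| dξ is `U` applied to an average of slices with coefficients of modulus at
most 1, and the jet of that average is bounded by sup_x ∫ |∂Φ(ξ, x)| dξ (`Jet.integrable_dual`).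
Derivatives in ξ pass onto Φ, so U(Φ(ξ, ·)) lies in 𝓓_{L¹}.

Both the kernel and the reflected test function φ(-·) are admissible κ. The first gives g = w^μ
U(Φ(ξ, ·)) in w^μ 𝓓_{L¹}. The second expresses f̌ * φ, and since the kernel times w^μ is bounded,
the product of the kernel with f̌ * φ is an integrable function. It therefore lies in 𝓓'_{L¹}, and
its pairing with 1 is its integral.

What remains is ∫ φ g = ∫ K (f̌ * φ), an interchange of `U` with an integral over ξ
(`integral_linearForm_eq`). Cutting off in x makes the slices norm integrable, so the interchange
holds for Bochner integrals of jets; the tightness of `U` removes the cutoff. -/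

/-- `Φ` is smooth and each of its derivatives is bounded by a multiple of `ρ`. -/
def DerivBound (ρ : E → ℝ) (Φ : E → ℂ) : Prop :=
  ContDiff ℝ ∞ Φ ∧ ∀ k : ℕ, ∃ C : ℝ, 0 ≤ C ∧ ∀ p, ‖iteratedFDeriv ℝ k Φ p‖ ≤ C * ρ p

theorem DerivBound.mono {ρ σ : E → ℝ} {Φ : E → ℂ} (h : DerivBound ρ Φ) {c : ℝ} (hc : 0 ≤ c)
    (hρ : ∀ p, ρ p ≤ c * σ p) : DerivBound σ Φ := by
  refine ⟨h.1, fun k => ?_⟩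
  obtain ⟨C, hC, h1⟩ := h.2 k
  refine ⟨C * c, mul_nonneg hC hc, fun p => (h1 p).trans ?_⟩
  rw [mul_assoc]
  exact mul_le_mul_of_nonneg_left (hρ p) hC

theorem DerivBound.mul {ρ σ : E → ℝ} {Φ Ψ : E → ℂ} (hΦ : DerivBound ρ Φ) (hΨ : DerivBound σ Ψ) :
    DerivBound (fun p => ρ p * σ p) (fun p => Φ p * Ψ p) := by
  refine ⟨hΦ.1.mul hΨ.1, fun k => ?_⟩
  choose C hC0 hC using hΦ.2
  choose D hD0 hD using hΨ.2
  refine ⟨∑ i ∈ Finset.range (k + 1), (k.choose i : ℝ) * C i * D (k - i), ?_, fun p => ?_⟩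
  · exact Finset.sum_nonneg fun i _ => mul_nonneg (mul_nonneg (by positivity) (hC0 _)) (hD0 _)
  · refine (norm_iteratedFDeriv_mul_le hΦ.1 hΨ.1 p (n := k) (by exact_mod_cast le_top)).trans ?_
    rw [Finset.sum_mul]
    refine Finset.sum_le_sum fun i _ => ?_
    have h1 := mul_le_mul (hC i p) (hD (k - i) p) (norm_nonneg _) ((norm_nonneg _).trans (hC i p))
    calc _ = (k.choose i : ℝ) * (‖iteratedFDeriv ℝ i Φ p‖ * ‖iteratedFDeriv ℝ (k - i) Ψ p‖) := by
            ring
      _ ≤ (k.choose i : ℝ) * ((C i * ρ p) * (D (k - i) * σ p)) :=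
            mul_le_mul_of_nonneg_left h1 (by positivity)
      _ = _ := by ring

theorem norm_iteratedFDeriv_comp_clm_le {Φ : E → ℂ} (h : ContDiff ℝ ∞ Φ) (L : F →L[ℝ] E) (k : ℕ)
    (p : F) : ‖iteratedFDeriv ℝ k (fun p => Φ (L p)) p‖ ≤
      ‖iteratedFDeriv ℝ k Φ (L p)‖ * ‖L‖ ^ k := by
  have h2 := L.iteratedFDeriv_comp_right h p (i := k) (by exact_mod_cast le_top)
  have h3 : (fun p => Φ (L p)) = Φ ∘ L := rfl
  rw [h3, h2]
  refine (ContinuousMultilinearMap.norm_compContinuousLinearMap_le _ _).trans ?_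
  rw [Finset.prod_const, Finset.card_univ, Fintype.card_fin]

theorem DerivBound.comp_clm {ρ : E → ℝ} {Φ : E → ℂ} (h : DerivBound ρ Φ) (L : F →L[ℝ] E) :
    DerivBound (fun p => ρ (L p)) (fun p => Φ (L p)) := by
  refine ⟨h.1.comp L.contDiff, fun k => ?_⟩
  obtain ⟨C, hC, h1⟩ := h.2 k
  refine ⟨C * ‖L‖ ^ k, by positivity, fun p => (norm_iteratedFDeriv_comp_clm_le h.1 L k p).trans ?_⟩
  calc _ ≤ (C * ρ (L p)) * ‖L‖ ^ k := mul_le_mul_of_nonneg_right (h1 _) (by positivity)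
    _ = _ := by ring

theorem DerivBound.fderiv_apply {ρ : E → ℝ} {Φ : E → ℂ} (h : DerivBound ρ Φ) (v : E) :
    DerivBound ρ (fun p => fderiv ℝ Φ p v) := by
  have h0 : ContDiff ℝ ∞ (fderiv ℝ Φ) := h.1.fderiv_right (by exact_mod_cast le_top)
  refine ⟨h0.clm_apply contDiff_const, fun k => ?_⟩
  obtain ⟨C, hC, h1⟩ := h.2 (k + 1)
  refine ⟨‖v‖ * C, by positivity, fun p => ?_⟩
  refine (norm_iteratedFDeriv_clm_apply_const h0.contDiffAt (n := k)
    (by exact_mod_cast le_top)).trans ?_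
  rw [norm_iteratedFDeriv_fderiv, mul_assoc]
  exact mul_le_mul_of_nonneg_left (h1 p) (norm_nonneg v)

theorem DerivBound.norm_le {ρ : E → ℝ} {Φ : E → ℂ} (h : DerivBound ρ Φ) :
    ∃ C, 0 ≤ C ∧ ∀ p, ‖Φ p‖ ≤ C * ρ p := by
  simpa only [norm_iteratedFDeriv_zero] using h.2 0

end Dominated

/-! ### Families of functions that are closed under partial derivatives -/

variable {n : ℕ}

/-- The functions `H i` are the partial derivatives of `G`. -/
def HasPartials (G : Rn n → ℂ) (H : Fin n → Rn n → ℂ) : Prop :=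
  ∀ ξ, HasFDerivAt G (∑ i, (EuclideanSpace.proj i : Rn n →L[ℝ] ℝ).smulRight (H i ξ)) ξ

theorem HasPartials.add {F G : Rn n → ℂ} {F' G' : Fin n → Rn n → ℂ} (hF : HasPartials F F')
    (hG : HasPartials G G') : HasPartials (F + G) (fun i => F' i + G' i) := by
  intro ξ
  refine ((hF ξ).add (hG ξ)).congr_fderiv ?_
  ext v
  simp [Finset.sum_add_distrib]

theorem HasPartials.mul {F G : Rn n → ℂ} {F' G' : Fin n → Rn n → ℂ} (hF : HasPartials F F')
    (hG : HasPartials G G') : HasPartials (F * G) (fun i => F * G' i + F' i * G) := by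
  intro ξ
  refine ((hF ξ).mul (hG ξ)).congr_fderiv ?_
  ext v
  simp only [mul_add, Finset.sum_add_distrib, add_apply, smul_apply,
    sum_apply, ContinuousLinearMap.smulRight_apply, PiLp.proj_apply,
    Complex.real_smul, Pi.add_apply, Pi.mul_apply, smul_eq_mul, Finset.mul_sum]
  congr 1 <;> exact Finset.sum_congr rfl fun i _ => by ring

/-- The derivative of a function in terms of its partial derivatives. -/
theorem HasPartials.fderiv_eq {G : Rn n → ℂ} {H : Fin n → Rn n → ℂ} (h : HasPartials G H) :
    fderiv ℝ G = fun ξ => ∑ i,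
      ContinuousLinearMap.smulRightL ℝ (Rn n) ℂ (EuclideanSpace.proj i) (H i ξ) :=
  funext fun ξ => (h ξ).fderiv

variable {𝒞 : Set (Rn n → ℂ)}

/-- The derivative of a member is a sum of members with constant coefficients, so one more order of
smoothness follows from the previous order for all members at once. -/
theorem contDiff_of_hasPartials (h𝒞 : ∀ G ∈ 𝒞, ∃ H, (∀ i, H i ∈ 𝒞) ∧ HasPartials G H)
    {G : Rn n → ℂ} (hG : G ∈ 𝒞) : ContDiff ℝ ∞ G := by
  refine contDiff_infty.2 fun k => ?_
  induction k generalizing G with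
  | zero =>
    obtain ⟨H, -, h⟩ := h𝒞 G hG
    exact contDiff_zero.2 (continuous_iff_continuousAt.2 fun x => (h x).continuousAt)
  | succ k ih =>
    obtain ⟨H, hH, h⟩ := h𝒞 G hG
    rw [Nat.cast_succ, contDiff_succ_iff_fderiv]
    refine ⟨fun x => (h x).differentiableAt, fun h => absurd h (by simp), ?_⟩
    rw [h.fderiv_eq]
    exact ContDiff.sum fun i _ => (ContinuousLinearMap.contDiff _).comp (ih (hH i))

/-- Reduces pointwise and integral estimates of every derivative to estimates of the members of 𝒞
themselves. -/
theorem norm_iteratedFDeriv_le_of_hasPartials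
    (h𝒞 : ∀ G ∈ 𝒞, ∃ H, (∀ i, H i ∈ 𝒞) ∧ HasPartials G H) (k : ℕ)
    {G : Rn n → ℂ} (hG : G ∈ 𝒞) :
    ∃ (s : Finset (Rn n → ℂ)) (C : ℝ), (↑s ⊆ 𝒞) ∧ 0 ≤ C ∧
      ∀ ξ, ‖iteratedFDeriv ℝ k G ξ‖ ≤ C * ∑ H ∈ s, ‖H ξ‖ := by
  classical
  induction k generalizing G with
  | zero => exact ⟨{G}, 1, by simpa using hG, zero_le_one, fun ξ => by simp⟩
  | succ k ih =>
    obtain ⟨H, hH, h⟩ := h𝒞 G hG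
    choose s C hs hC hb using fun i => ih (hH i)
    set L : Fin n → ℂ →L[ℝ] Rn n →L[ℝ] ℂ := fun i =>
      ContinuousLinearMap.smulRightL ℝ (Rn n) ℂ (EuclideanSpace.proj i) with hL
    refine ⟨Finset.univ.biUnion s, ∑ i, ‖L i‖ * C i, ?_, ?_, fun ξ => ?_⟩
    · intro f hf
      simp only [Finset.coe_biUnion, Set.mem_iUnion] at hf
      obtain ⟨i, -, hi⟩ := hf
      exact hs i hi
    · exact Finset.sum_nonneg fun i _ => mul_nonneg (norm_nonneg (L i)) (hC i)
    · have hd : ∀ i, ContDiff ℝ k (H i) := fun i =>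
        (contDiff_of_hasPartials h𝒞 (hH i)).of_le (by exact_mod_cast le_top)
      have hf : fderiv ℝ G = fun ξ => ∑ i, (L i ∘ H i) ξ := h.fderiv_eq
      rw [← norm_iteratedFDeriv_fderiv, hf, iteratedFDeriv_fun_sum_apply
        (fun i _ => ((L i).contDiff.comp (hd i)).contDiffAt), Finset.sum_mul]
      refine (norm_sum_le _ _).trans (Finset.sum_le_sum fun i _ => ?_)
      refine ((L i).norm_iteratedFDeriv_comp_left (hd i).contDiffAt le_rfl).trans ?_
      rw [mul_assoc]
      refine mul_le_mul_of_nonneg_left ((hb i ξ).trans ?_) (norm_nonneg _)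
      exact mul_le_mul_of_nonneg_left (Finset.sum_le_sum_of_subset_of_nonneg
        (Finset.subset_biUnion_of_mem s (Finset.mem_univ i)) fun _ _ _ => norm_nonneg _) (hC i)

theorem derivBound_of_hasPartials {ρ : Rn n → ℝ}
    (h𝒞 : ∀ G ∈ 𝒞, ∃ H, (∀ i, H i ∈ 𝒞) ∧ HasPartials G H)
    (hb : ∀ G ∈ 𝒞, ∃ C, 0 ≤ C ∧ ∀ ξ, ‖G ξ‖ ≤ C * ρ ξ) {G : Rn n → ℂ} (hG : G ∈ 𝒞) :
    DerivBound ρ G := by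
  refine ⟨contDiff_of_hasPartials h𝒞 hG, fun k => ?_⟩
  obtain ⟨s, C, hs, hC, h⟩ := norm_iteratedFDeriv_le_of_hasPartials h𝒞 k hG
  have hb' : ∀ H : s, ∃ C, 0 ≤ C ∧ ∀ ξ, ‖(H : Rn n → ℂ) ξ‖ ≤ C * ρ ξ := fun H => hb H (hs H.2)
  choose D hD hD' using hb'
  refine ⟨C * ∑ H, D H, mul_nonneg hC (Finset.sum_nonneg fun H _ => hD H), fun ξ =>
    (h ξ).trans ?_⟩
  rw [mul_assoc, Finset.sum_mul, ← Finset.sum_coe_sort]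
  exact mul_le_mul_of_nonneg_left (Finset.sum_le_sum fun H _ => hD' H ξ) hC

/-! ### The weights -/

/-- The weight `w(x) = (1 + |x|²)^{1/2}`. -/
def wt (x : Rn n) : ℝ := (1 + ‖x‖ ^ 2) ^ (1 / 2 : ℝ)

theorem wt_eq_sqrt (x : Rn n) : wt x = √(1 + ‖x‖ ^ 2) := (Real.sqrt_eq_rpow _).symm

theorem one_le_wt (x : Rn n) : 1 ≤ wt x :=
  Real.one_le_rpow (by nlinarith [norm_nonneg x]) (by norm_num)

theorem wt_pos (x : Rn n) : 0 < wt x := zero_lt_one.trans_le (one_le_wt x)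

theorem wPow_eq (s : ℝ) (x : Rn n) : wPow s x = ((wt x ^ s : ℝ) : ℂ) := rfl

theorem wt_neg (x : Rn n) : wt (-x) = wt x := by simp [wt]

theorem wPow_neg_arg (s : ℝ) (x : Rn n) : wPow s (-x) = wPow s x := by
  rw [wPow_eq, wPow_eq, wt_neg]

theorem norm_wPow (s : ℝ) (x : Rn n) : ‖wPow s x‖ = wt x ^ s := by
  rw [wPow_eq, Complex.norm_real, Real.norm_of_nonneg (Real.rpow_nonneg (wt_pos x).le _)]

theorem wPow_mul_wPow (s t : ℝ) (x : Rn n) : wPow s x * wPow t x = wPow (s + t) x := by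
  rw [wPow_eq, wPow_eq, wPow_eq, ← Complex.ofReal_mul, Real.rpow_add (wt_pos x)]

theorem wPow_zero (x : Rn n) : wPow 0 x = 1 := by simp [wPow_eq]

theorem norm_le_wt (x : Rn n) : ‖x‖ ≤ wt x := by
  rw [wt_eq_sqrt]
  exact Real.le_sqrt_of_sq_le (by linarith)

theorem wt_le_add (x y : Rn n) : wt (x + y) ≤ wt x + wt y := by
  have h1 := one_le_wt x
  have h2 := one_le_wt y
  rw [wt_eq_sqrt (x + y), Real.sqrt_le_left (by linarith)]
  have h3 : wt x ^ 2 = 1 + ‖x‖ ^ 2 := by rw [wt_eq_sqrt, Real.sq_sqrt (by positivity)]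
  have h4 : wt y ^ 2 = 1 + ‖y‖ ^ 2 := by rw [wt_eq_sqrt, Real.sq_sqrt (by positivity)]
  have h5 := norm_add_le x y
  have h6 : ‖x + y‖ ^ 2 ≤ (‖x‖ + ‖y‖) ^ 2 := by gcongr
  have h7 : ‖x‖ * ‖y‖ ≤ wt x * wt y :=
    mul_le_mul (norm_le_wt x) (norm_le_wt y) (norm_nonneg _) (wt_pos x).le
  nlinarith

/-- The form of Peetre's inequality that splits the weight. -/
theorem wt_rpow_le {μ : ℝ} (hμ : 0 ≤ μ) (ξ x : Rn n) :
    wt x ^ μ ≤ 2 ^ μ * (wt ξ ^ μ + wt (ξ - x) ^ μ) := by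
  have h0 : wt x ≤ wt ξ + wt (ξ - x) := by
    have := wt_le_add ξ (x - ξ)
    rwa [add_sub_cancel, ← wt_neg (x - ξ), neg_sub] at this
  have h1 : wt x ≤ 2 * max (wt ξ) (wt (ξ - x)) := by
    linarith [le_max_left (wt ξ) (wt (ξ - x)), le_max_right (wt ξ) (wt (ξ - x))]
  have hm : 0 ≤ max (wt ξ) (wt (ξ - x)) := (wt_pos ξ).le.trans (le_max_left _ _)
  refine (Real.rpow_le_rpow (wt_pos x).le h1 hμ).trans ?_
  rw [Real.mul_rpow zero_le_two hm]
  refine mul_le_mul_of_nonneg_left ?_ (by positivity)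
  have p1 := Real.rpow_nonneg (wt_pos ξ).le μ
  have p2 := Real.rpow_nonneg (wt_pos (ξ - x)).le μ
  rcases max_choice (wt ξ) (wt (ξ - x)) with h | h <;> rw [h] <;> linarith

/-- The hypothesis α > -1 enters through this threshold, since it says that α + n + 1 > n. -/
theorem wt_rpow_integrable {μ : ℝ} (hμ : (n : ℝ) < μ) :
    Integrable (fun x : Rn n => wt x ^ (-μ)) := by
  have := integrable_rpow_neg_one_add_norm_sq (E := Rn n) (μ := volume) (r := μ) (by simpa using hμ)
  refine this.congr (Eventually.of_forall fun x => ?_)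
  simp only [wt]
  rw [← Real.rpow_mul (by positivity)]
  congr 1
  ring

theorem continuous_wPow (s : ℝ) : Continuous (wPow s : Rn n → ℂ) :=
  (wPow_hasTemperateGrowth s).1.continuous

theorem continuous_wt : Continuous (wt : Rn n → ℝ) := by
  have : (wt : Rn n → ℝ) = fun x => √(1 + ‖x‖ ^ 2) := funext wt_eq_sqrt
  rw [this]
  fun_prop

/-- The function `x ↦ xᵢ / w(x)`. -/
def coordDir (i : Fin n) (x : Rn n) : ℂ := (x i : ℂ) * wPow (-1) x

theorem hasPartials_wPow (s : ℝ) :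
    HasPartials (wPow s : Rn n → ℂ)
      (fun i => (fun _ => (s : ℂ)) * coordDir i * wPow (-1) * wPow s) := by
  intro x
  have h1 : HasFDerivAt (fun x : Rn n => 1 + ‖x‖ ^ 2) (2 • innerSL ℝ x) x :=
    (hasStrictFDerivAt_norm_sq x).hasFDerivAt.const_add 1
  have h2 := Complex.ofRealCLM.hasFDerivAt.comp x
    (h1.rpow_const (p := s / 2) (Or.inl (by positivity)))
  have h3 : (wPow s : Rn n → ℂ) = fun x => (((1 + ‖x‖ ^ 2) ^ (s / 2) : ℝ) : ℂ) := by
    funext y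
    rw [wPow_eq, wt, ← Real.rpow_mul (by positivity)]
    congr 2
    ring
  rw [h3]
  refine h2.congr_fderiv ?_
  ext v
  have h4 : ∀ y : Rn n, wPow (-1) y * wPow (-1) y * wPow s y =
      (((1 + ‖y‖ ^ 2) ^ (s / 2 - 1) : ℝ) : ℂ) := by
    intro y
    rw [wPow_mul_wPow, wPow_mul_wPow, wPow_eq, wt, ← Real.rpow_mul (by positivity)]
    congr 2
    ring
  have h5 : ∀ i : Fin n, (v i : ℂ) * ((s : ℂ) * coordDir i x * wPow (-1) x *
      (((1 + ‖x‖ ^ 2) ^ (s / 2) : ℝ) : ℂ)) =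
      (s * ((1 + ‖x‖ ^ 2) ^ (s / 2 - 1) : ℝ) : ℂ) * ((v i : ℂ) * (x i : ℂ)) := by
    intro i
    rw [← h4, ← congrFun h3 x, coordDir]
    ring
  simp only [sum_apply, ContinuousLinearMap.smulRight_apply,
    PiLp.proj_apply, Complex.real_smul, Pi.mul_apply, h5]
  rw [← Finset.mul_sum]
  simp only [ContinuousLinearMap.comp_apply, smul_apply, innerSL_apply_apply,
    PiLp.inner_apply, RCLike.inner_apply, conj_trivial, Complex.ofRealCLM_apply, smul_eq_mul,
    nsmul_eq_mul]
  push_cast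
  ring

theorem hasPartials_coordDir (i : Fin n) :
    HasPartials (coordDir i) (fun j => (fun _ => if i = j then 1 else 0) * wPow (-1) +
      (fun _ => (-1 : ℂ)) * (coordDir i * coordDir j) * wPow (-1)) := by
  have h1 : HasPartials (fun x : Rn n => (x i : ℂ)) (fun j _ => if i = j then 1 else 0) := by
    intro x
    have h := Complex.ofRealCLM.hasFDerivAt.comp x
      (EuclideanSpace.proj i : Rn n →L[ℝ] ℝ).hasFDerivAt
    refine h.congr_fderiv ?_
    ext v
    simp
  intro x
  refine (h1.mul (hasPartials_wPow (-1)) x).congr_fderiv ?_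
  ext v
  simp only [sum_apply, ContinuousLinearMap.smulRight_apply, PiLp.proj_apply,
    Complex.real_smul, Pi.add_apply, Pi.mul_apply, coordDir]
  refine Finset.sum_congr rfl fun j _ => ?_
  push_cast
  ring

/-- The algebra of functions generated by `1 / w` and the `xᵢ / w`. -/
def symbolAlg (n : ℕ) : Subalgebra ℂ (Rn n → ℂ) :=
  Algebra.adjoin ℂ ({wPow (-1)} ∪ Set.range coordDir)

theorem wPow_mem_symbolAlg : (wPow (-1) : Rn n → ℂ) ∈ symbolAlg n :=
  Algebra.subset_adjoin (Or.inl rfl)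

theorem coordDir_mem_symbolAlg (i : Fin n) : coordDir i ∈ symbolAlg n :=
  Algebra.subset_adjoin (Or.inr ⟨i, rfl⟩)

theorem const_mem_symbolAlg (c : ℂ) : (fun _ => c) ∈ symbolAlg n :=
  (symbolAlg n).algebraMap_mem c

/-- The generators have partial derivatives that are polynomials in the generators; sums and
products inherit this by the Leibniz rule. -/
theorem symbolAlg_hasPartials {p : Rn n → ℂ} (hp : p ∈ symbolAlg n) :
    ∃ q : Fin n → Rn n → ℂ, (∀ i, q i ∈ symbolAlg n) ∧ HasPartials p q := by
  refine Algebra.adjoin_induction (p := fun p _ => ∃ q : Fin n → Rn n → ℂ,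
    (∀ i, q i ∈ symbolAlg n) ∧ HasPartials p q) ?_ ?_ ?_ ?_ hp
  · rintro p (rfl | ⟨i, rfl⟩)
    · exact ⟨_, fun i => mul_mem (mul_mem (mul_mem (const_mem_symbolAlg _)
        (coordDir_mem_symbolAlg i)) wPow_mem_symbolAlg) wPow_mem_symbolAlg, hasPartials_wPow (-1)⟩
    · exact ⟨_, fun j => add_mem (mul_mem (const_mem_symbolAlg _) wPow_mem_symbolAlg)
        (mul_mem (mul_mem (const_mem_symbolAlg _) (mul_mem (coordDir_mem_symbolAlg i)
          (coordDir_mem_symbolAlg j))) wPow_mem_symbolAlg), hasPartials_coordDir i⟩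
  · intro c
    refine ⟨fun _ _ => 0, fun _ => const_mem_symbolAlg 0, fun x => ?_⟩
    have h : HasFDerivAt (fun _ : Rn n => c) (0 : Rn n →L[ℝ] ℂ) x := hasFDerivAt_const c x
    refine h.congr_fderiv ?_
    ext v
    simp
  · rintro p q - - ⟨p', hp', hp⟩ ⟨q', hq', hq⟩
    exact ⟨_, fun i => add_mem (hp' i) (hq' i), hp.add hq⟩
  · rintro p q hpm hqm ⟨p', hp', hp⟩ ⟨q', hq', hq⟩
    exact ⟨_, fun i => add_mem (mul_mem hpm (hq' i)) (mul_mem (hp' i) hqm), hp.mul hq⟩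

theorem symbolAlg_bounded {p : Rn n → ℂ} (hp : p ∈ symbolAlg n) :
    ∃ C, 0 ≤ C ∧ ∀ x, ‖p x‖ ≤ C := by
  have hw : ∀ x : Rn n, ‖wPow (-1) x‖ ≤ 1 := fun x => by
    rw [norm_wPow]
    exact Real.rpow_le_one_of_one_le_of_nonpos (one_le_wt x) (by norm_num)
  refine Algebra.adjoin_induction (p := fun p _ => ∃ C, 0 ≤ C ∧ ∀ x, ‖p x‖ ≤ C) ?_ ?_ ?_ ?_ hp
  · rintro p (rfl | ⟨i, rfl⟩)
    · exact ⟨1, zero_le_one, hw⟩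
    · refine ⟨1, zero_le_one, fun x => ?_⟩
      rw [coordDir, norm_mul, norm_wPow, Complex.norm_real, Real.rpow_neg_one,
        ← div_eq_mul_inv, div_le_one (wt_pos x)]
      exact (PiLp.norm_apply_le x i).trans (norm_le_wt x)
  · exact fun c => ⟨‖c‖, norm_nonneg c, fun x => le_rfl⟩
  · rintro p q - - ⟨C, hC, hp⟩ ⟨D, hD, hq⟩
    exact ⟨C + D, add_nonneg hC hD, fun x => (norm_add_le _ _).trans (add_le_add (hp x) (hq x))⟩
  · rintro p q - - ⟨C, hC, hp⟩ ⟨D, hD, hq⟩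
    exact ⟨C * D, mul_nonneg hC hD, fun x =>
      (norm_mul_le _ _).trans (mul_le_mul (hp x) (hq x) (norm_nonneg _) hC)⟩

/-- The products p · w^s with p in the bounded algebra `symbolAlg` form a family closed under
partial derivatives. -/
theorem derivBound_wPow (s : ℝ) : DerivBound (fun x : Rn n => wt x ^ s) (wPow s) := by
  refine derivBound_of_hasPartials (𝒞 := {G | ∃ p ∈ symbolAlg n, G = p * wPow s}) ?_ ?_
    ⟨1, one_mem _, (one_mul _).symm⟩
  · rintro _ ⟨p, hp, rfl⟩
    obtain ⟨q, hq, h⟩ := symbolAlg_hasPartials hp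
    refine ⟨_, fun i => ?_, h.mul (hasPartials_wPow s)⟩
    refine ⟨p * ((fun _ => (s : ℂ)) * coordDir i * wPow (-1)) + q i, add_mem (mul_mem hp
      (mul_mem (mul_mem (const_mem_symbolAlg _) (coordDir_mem_symbolAlg i)) wPow_mem_symbolAlg))
      (hq i), ?_⟩
    ring
  · rintro _ ⟨p, hp, rfl⟩
    obtain ⟨C, hC, h⟩ := symbolAlg_bounded hp
    refine ⟨C, hC, fun x => ?_⟩
    rw [Pi.mul_apply, norm_mul, norm_wPow]
    exact mul_le_mul_of_nonneg_right (h x) (Real.rpow_nonneg (wt_pos x).le _)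

end

section

/-! ### Iterated derivatives, directional derivatives and Taylor's formula -/

section Taylor

variable {E V : Type*} [NormedAddCommGroup E] [NormedSpace ℝ E]
  [NormedAddCommGroup V] [NormedSpace ℝ V]

/-- Symmetry of second derivatives moves the direction v past the other k. This lets the linear term
of Taylor's formula for a jet be read as the jet of a directional derivative. -/
theorem iteratedFDeriv_fderiv_apply {Φ : E → V} (hΦ : ContDiff ℝ ∞ Φ) (v : E) (k : ℕ) (p : E) :
    iteratedFDeriv ℝ k (fun q => fderiv ℝ Φ q v) p = fderiv ℝ (iteratedFDeriv ℝ k Φ) p v := by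
  induction k generalizing p with
  | zero =>
    ext m
    have h : fderiv ℝ (iteratedFDeriv ℝ 0 Φ) p v m = iteratedFDeriv ℝ 1 Φ p ![v] := by
      rw [iteratedFDeriv_succ_apply_left]
      congr 1
      exact Subsingleton.elim _ _
    rw [h, iteratedFDeriv_one_apply, iteratedFDeriv_zero_apply]
    rfl
  | succ k ih =>
    have hk : ContDiff ℝ ∞ (iteratedFDeriv ℝ k Φ) :=
      hΦ.iteratedFDeriv_right (by exact_mod_cast le_top)
    have hk1 : ContDiff ℝ ∞ (iteratedFDeriv ℝ (k + 1) Φ) :=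
      hΦ.iteratedFDeriv_right (by exact_mod_cast le_top)
    have hf : ContDiff ℝ ∞ (fderiv ℝ (iteratedFDeriv ℝ k Φ)) :=
      hk.fderiv_right (by exact_mod_cast le_top)
    have hfd : DifferentiableAt ℝ (fderiv ℝ (iteratedFDeriv ℝ k Φ)) p :=
      hf.differentiable (by simp) p
    ext m
    rw [iteratedFDeriv_succ_apply_left, funext ih]
    have h1 : fderiv ℝ (iteratedFDeriv ℝ (k + 1) Φ) p v m =
        fderiv ℝ (fun q => iteratedFDeriv ℝ (k + 1) Φ q m) p v := by
      rw [fderiv_continuousMultilinear_apply_const_apply (hk1.differentiable (by simp) p)]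
    have h2 : (fun q => iteratedFDeriv ℝ (k + 1) Φ q m) =
        fun q => fderiv ℝ (iteratedFDeriv ℝ k Φ) q (m 0) (Fin.tail m) := rfl
    rw [h1, h2, fderiv_continuousMultilinear_apply_const_apply
      (hfd.clm_apply (differentiableAt_const _)), fderiv_clm_apply hfd (differentiableAt_const _),
      fderiv_clm_apply hfd (differentiableAt_const _)]
    simp only [fderiv_fun_const, Pi.zero_apply, ContinuousLinearMap.comp_zero, zero_add,
      ContinuousLinearMap.flip_apply]
    have hs : IsSymmSndFDerivAt ℝ (iteratedFDeriv ℝ k Φ) p :=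
      hk.contDiffAt.isSymmSndFDerivAt 
        (by rw [minSmoothness_of_isRCLikeNormedField]
            exact WithTop.coe_le_coe.2 (le_top : (2 : ℕ∞) ≤ ⊤))
    rw [hs.eq]

theorem norm_iteratedFDeriv_sub_le {Φ : E → V} (hΦ : ContDiff ℝ ∞ Φ) {k : ℕ} {C : ℝ}
    (hC : ∀ p, ‖iteratedFDeriv ℝ (k + 1) Φ p‖ ≤ C) (p q : E) :
    ‖iteratedFDeriv ℝ k Φ q - iteratedFDeriv ℝ k Φ p‖ ≤ C * ‖q - p‖ := by
  have hk : ContDiff ℝ ∞ (iteratedFDeriv ℝ k Φ) :=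
    hΦ.iteratedFDeriv_right (by exact_mod_cast le_top)
  refine Convex.norm_image_sub_le_of_norm_fderiv_le (𝕜 := ℝ) (s := Set.univ)
    (fun x _ => hk.differentiable (by simp) x) (fun x _ => ?_) convex_univ trivial trivial
  rw [norm_fderiv_iteratedFDeriv]
  exact hC x

theorem norm_iteratedFDeriv_taylor_le {Φ : E → V} (hΦ : ContDiff ℝ ∞ Φ) {k : ℕ} {C : ℝ}
    (hC : ∀ p, ‖iteratedFDeriv ℝ (k + 2) Φ p‖ ≤ C) (p h : E) :
    ‖iteratedFDeriv ℝ k Φ (p + h) - iteratedFDeriv ℝ k Φ p -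
      iteratedFDeriv ℝ k (fun q => fderiv ℝ Φ q h) p‖ ≤ C * ‖h‖ * ‖h‖ := by
  have hk : ContDiff ℝ ∞ (iteratedFDeriv ℝ k Φ) :=
    hΦ.iteratedFDeriv_right (by exact_mod_cast le_top)
  have hC0 : 0 ≤ C := (norm_nonneg _).trans (hC p)
  rw [iteratedFDeriv_fderiv_apply hΦ]
  -- Mean value inequality for the k-th derivative minus its linear part at p: on the ball of radius
  -- ‖h‖ its derivative is at most C‖h‖.
  have key := Convex.norm_image_sub_le_of_norm_fderiv_le' (𝕜 := ℝ) (s := Metric.closedBall p ‖h‖)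
    (f := iteratedFDeriv ℝ k Φ) (φ := fderiv ℝ (iteratedFDeriv ℝ k Φ) p) (C := C * ‖h‖)
    (x := p) (y := p + h) (fun x _ => hk.differentiable (by simp) x) (fun x hx => ?_)
    (convex_closedBall _ _) (Metric.mem_closedBall_self (norm_nonneg h)) (by simp)
  · simpa using key
  · have hn : ‖fderiv ℝ (iteratedFDeriv ℝ k Φ) x - fderiv ℝ (iteratedFDeriv ℝ k Φ) p‖ =
        ‖iteratedFDeriv ℝ (k + 1) Φ x - iteratedFDeriv ℝ (k + 1) Φ p‖ := by
      rw [← (continuousMultilinearCurryLeftEquiv ℝ (fun _ : Fin (k + 1) => E) V).norm_map]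
      rfl
    rw [hn]
    refine (norm_iteratedFDeriv_sub_le hΦ hC p x).trans ?_
    rw [← dist_eq_norm]
    exact mul_le_mul_of_nonneg_left hx hC0

end Taylor

/-! ### Jets and slices -/

variable {n : ℕ}

/-- The Banach space of families of bounded continuous functions that contains the families of
derivatives of order at most `m` of the functions in `𝓑`. -/
def Jet (n m : ℕ) : Type :=
  (k : Fin (m + 1)) → (Rn n →ᵇ (Rn n [×(k : ℕ)]→L[ℝ] ℂ))

instance (m : ℕ) : NormedAddCommGroup (Jet n m) := inferInstanceAs (NormedAddCommGroup
  ((k : Fin (m + 1)) → (Rn n →ᵇ (Rn n [×(k : ℕ)]→L[ℝ] ℂ))))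

instance (m : ℕ) : NormedSpace ℂ (Jet n m) := inferInstanceAs (NormedSpace ℂ
  ((k : Fin (m + 1)) → (Rn n →ᵇ (Rn n [×(k : ℕ)]→L[ℝ] ℂ))))

instance (m : ℕ) : CompleteSpace (Jet n m) := inferInstanceAs (CompleteSpace
  ((k : Fin (m + 1)) → (Rn n →ᵇ (Rn n [×(k : ℕ)]→L[ℝ] ℂ))))

theorem Jet.norm_le_iff {m : ℕ} {F : Jet n m} {C : ℝ} (hC : 0 ≤ C) :
    ‖F‖ ≤ C ↔ ∀ k x, ‖F k x‖ ≤ C :=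
  (pi_norm_le_iff_of_nonneg hC).trans
    (forall_congr' fun _ => BoundedContinuousFunction.norm_le hC)

theorem Jet.norm_apply_le {m : ℕ} (F : Jet n m) (k : Fin (m + 1)) (x : Rn n) :
    ‖F k x‖ ≤ ‖F‖ := (Jet.norm_le_iff (norm_nonneg F)).1 le_rfl k x

/-- Evaluation of the `k`-th component at a point. -/
def Jet.eval {m : ℕ} (k : Fin (m + 1)) (x : Rn n) : Jet n m →L[ℂ] (Rn n [×(k : ℕ)]→L[ℝ] ℂ) :=
  LinearMap.mkContinuous
    { toFun := fun F => F k x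
      map_add' := fun _ _ => rfl
      map_smul' := fun _ _ => rfl } 1 fun F => by
    rw [one_mul]
    exact F.norm_apply_le k x

theorem Jet.eval_apply {m : ℕ} (k : Fin (m + 1)) (x : Rn n) (F : Jet n m) :
    Jet.eval k x F = F k x := rfl

/-- The family of the derivatives of order at most `m`. -/
def B.jet (m : ℕ) : B n →ₗ[ℂ] Jet n m :=
  LinearMap.pi (φ := fun k : Fin (m + 1) => Rn n →ᵇ (Rn n [×(k : ℕ)]→L[ℝ] ℂ))
    fun k => B.deriv (k : ℕ)

theorem B.norm_jet_le {m : ℕ} {φ : B n} {C : ℝ} (hC : 0 ≤ C)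
    (h : ∀ k ≤ m, ∀ x, ‖iteratedFDeriv ℝ k (φ : Rn n → ℂ) x‖ ≤ C) : ‖B.jet m φ‖ ≤ C := by
  exact (Jet.norm_le_iff hC).2 fun k x => h k (Nat.lt_succ_iff.1 k.2) x

theorem B.norm_iteratedFDeriv_le_jet {m : ℕ} (φ : B n) {k : ℕ} (hk : k ≤ m) (x : Rn n) :
    ‖iteratedFDeriv ℝ k (φ : Rn n → ℂ) x‖ ≤ ‖B.jet m φ‖ :=
  (B.jet m φ).norm_apply_le ⟨k, Nat.lt_succ_iff.2 hk⟩ x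

theorem DerivBound.mem_B {ρ : Rn n → ℝ} {φ : Rn n → ℂ} (h : DerivBound ρ φ) {c : ℝ}
    (hρ : ∀ x, ρ x ≤ c) : φ ∈ B n := by
  refine ⟨h.1, fun k => ?_⟩
  obtain ⟨C, hC, hb⟩ := h.2 k
  exact ⟨C * c, fun x => (hb x).trans (mul_le_mul_of_nonneg_left (hρ x) hC)⟩

theorem B.derivBound (φ : B n) : DerivBound (fun _ => 1) (φ : Rn n → ℂ) := by
  refine ⟨φ.2.1, fun k => ?_⟩
  obtain ⟨C, hC⟩ := φ.2.2 k
  exact ⟨max C 0, le_max_right _ _, fun p => by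
    rw [mul_one]
    exact (hC p).trans (le_max_left _ _)⟩

theorem iteratedFDeriv_slice {Φ : Rn n × Rn n → ℂ} (hΦ : ContDiff ℝ ∞ Φ) (ξ x : Rn n) (k : ℕ) :
    iteratedFDeriv ℝ k (fun x => Φ (ξ, x)) x =
      (iteratedFDeriv ℝ k Φ (ξ, x)).compContinuousLinearMap
        (fun _ => ContinuousLinearMap.inr ℝ (Rn n) (Rn n)) := by
  have h1 : (fun x => Φ (ξ, x)) =
      (fun p => Φ ((ξ, 0) + p)) ∘ ContinuousLinearMap.inr ℝ (Rn n) (Rn n) := by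
    funext x
    simp
  have h2 : ContDiff ℝ ∞ (fun p => Φ ((ξ, 0) + p)) := hΦ.comp (contDiff_const.add contDiff_id)
  rw [h1, ContinuousLinearMap.iteratedFDeriv_comp_right _ h2 x (by exact_mod_cast le_top),
    iteratedFDeriv_comp_add_left]
  simp

theorem norm_comp_inr_le {k : ℕ} (a : (Rn n × Rn n) [×k]→L[ℝ] ℂ) :
    ‖a.compContinuousLinearMap (fun _ => ContinuousLinearMap.inr ℝ (Rn n) (Rn n))‖ ≤ ‖a‖ := by
  refine (ContinuousMultilinearMap.norm_compContinuousLinearMap_le _ _).trans ?_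
  refine mul_le_of_le_one_right (norm_nonneg a) (Finset.prod_le_one (fun _ _ => norm_nonneg _)
    fun _ _ => ContinuousLinearMap.norm_inr_le_one ℝ (Rn n) (Rn n))

theorem DerivBound.slice_bound {ρ : Rn n × Rn n → ℝ} {Φ : Rn n × Rn n → ℂ} (h : DerivBound ρ Φ)
    (k : ℕ) : ∃ C, 0 ≤ C ∧ ∀ ξ x, ‖iteratedFDeriv ℝ k (fun x => Φ (ξ, x)) x‖ ≤ C * ρ (ξ, x) := by
  obtain ⟨C, hC, hb⟩ := h.2 k
  refine ⟨C, hC, fun ξ x => ?_⟩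
  rw [iteratedFDeriv_slice h.1]
  exact (norm_comp_inr_le _).trans (hb _)

/-- The function `Φ(ξ, ·)`, as an element of `𝓑`. -/
def slice {Φ : Rn n × Rn n → ℂ} (h : DerivBound (fun _ => 1) Φ) (ξ : Rn n) : B n :=
  ⟨fun x => Φ (ξ, x), h.1.comp (contDiff_const.prodMk contDiff_id), fun k => by
    obtain ⟨C, -, hb⟩ := h.slice_bound k
    exact ⟨C * 1, hb ξ⟩⟩

@[simp] theorem slice_apply {Φ : Rn n × Rn n → ℂ} (h : DerivBound (fun _ => 1) Φ) (ξ x : Rn n) :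
    (slice h ξ : Rn n → ℂ) x = Φ (ξ, x) := rfl

theorem deriv_slice_apply {Φ : Rn n × Rn n → ℂ} (h : DerivBound (fun _ => 1) Φ) (ξ x : Rn n)
    (k : ℕ) : B.deriv k (slice h ξ) x = (iteratedFDeriv ℝ k Φ (ξ, x)).compContinuousLinearMap
        (fun _ => ContinuousLinearMap.inr ℝ (Rn n) (Rn n)) :=
  iteratedFDeriv_slice h.1 ξ x k

/-- The global bound on the derivatives of order k + 1 of Φ makes the k-th component Lipschitz in ξ,
uniformly in x. -/
theorem continuous_jet_slice {Φ : Rn n × Rn n → ℂ} (h : DerivBound (fun _ => 1) Φ) (m : ℕ) :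
    Continuous fun ξ => B.jet m (slice h ξ) := by
  choose C hC hb using fun k => h.2 (k + 1)
  have h0 : 0 ≤ ∑ k ∈ Finset.range (m + 1), C k := Finset.sum_nonneg fun k _ => hC k
  refine (LipschitzWith.of_dist_le_mul (K := (∑ k ∈ Finset.range (m + 1), C k).toNNReal)
    fun ξ ζ => ?_).continuous
  rw [Real.coe_toNNReal _ h0, dist_eq_norm, dist_eq_norm, Jet.norm_le_iff (by positivity)]
  intro k x
  have h1 := norm_iteratedFDeriv_sub_le h.1 (k := k) (C := C k) (fun p => by simpa using hb k p)
    (ζ, x) (ξ, x)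
  have h2 : (B.jet m (slice h ξ) - B.jet m (slice h ζ)) k x =
      (iteratedFDeriv ℝ k Φ (ξ, x) - iteratedFDeriv ℝ k Φ (ζ, x)).compContinuousLinearMap
        (fun _ => ContinuousLinearMap.inr ℝ (Rn n) (Rn n)) := by
    calc _ = B.deriv k (slice h ξ) x - B.deriv k (slice h ζ) x := rfl
      _ = _ := by
        rw [deriv_slice_apply, deriv_slice_apply]
        rfl
  have hv : ‖((ξ, x) : Rn n × Rn n) - (ζ, x)‖ = ‖ξ - ζ‖ := by simp [Prod.norm_def]
  rw [h2]
  rw [hv] at h1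
  refine (norm_comp_inr_le _).trans (h1.trans ?_)
  refine mul_le_mul_of_nonneg_right ?_ (norm_nonneg _)
  exact Finset.single_le_sum (f := C) (fun k _ => hC k) (Finset.mem_range.2 k.2)

/-- The quadratic remainder is uniform in x, so ξ ↦ Φ(ξ, ·) is differentiable in the supremum norm
of jets and not only pointwise. -/
theorem norm_jet_slice_taylor_le {Φ : Rn n × Rn n → ℂ} (h : DerivBound (fun _ => 1) Φ) (m : ℕ) :
    ∃ C, 0 ≤ C ∧ ∀ ξ v, ‖B.jet m (slice h (ξ + v)) - B.jet m (slice h ξ) -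
      B.jet m (slice (h.fderiv_apply (v, 0)) ξ)‖ ≤ C * ‖v‖ * ‖v‖ := by
  choose C hC hb using fun k => h.2 (k + 2)
  refine ⟨∑ k ∈ Finset.range (m + 1), C k, Finset.sum_nonneg fun k _ => hC k, fun ξ v => ?_⟩
  have h0 : 0 ≤ ∑ k ∈ Finset.range (m + 1), C k := Finset.sum_nonneg fun k _ => hC k
  refine (Jet.norm_le_iff (by positivity)).2 fun k x => ?_
  have h1 := norm_iteratedFDeriv_taylor_le h.1 (k := k) (C := C k) (fun p => by simpa using hb k p)
    (ξ, x) (v, 0)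
  have hv : ‖((v, 0) : Rn n × Rn n)‖ = ‖v‖ := by simp [Prod.norm_def]
  rw [hv] at h1
  have h2 : (B.jet m (slice h (ξ + v)) - B.jet m (slice h ξ) -
      B.jet m (slice (h.fderiv_apply (v, 0)) ξ)) k x =
      (iteratedFDeriv ℝ k Φ ((ξ, x) + (v, 0)) - iteratedFDeriv ℝ k Φ (ξ, x) -
      iteratedFDeriv ℝ k (fun q => fderiv ℝ Φ q (v, 0)) (ξ, x)).compContinuousLinearMap
        (fun _ => ContinuousLinearMap.inr ℝ (Rn n) (Rn n)) := by
    have h3 := deriv_slice_apply h (ξ + v) x k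
    have h4 := deriv_slice_apply h ξ x k
    have h5 := deriv_slice_apply (h.fderiv_apply (v, 0)) ξ x k
    have h6 : ((ξ, x) + (v, 0) : Rn n × Rn n) = (ξ + v, x) := by simp
    rw [h6]
    calc _ = B.deriv k (slice h (ξ + v)) x - B.deriv k (slice h ξ) x -
          B.deriv k (slice (h.fderiv_apply (v, 0)) ξ) x := rfl
      _ = _ := by
        rw [h3, h4, h5]
        rfl
  rw [h2]
  refine (norm_comp_inr_le _).trans (h1.trans ?_)
  refine mul_le_mul_of_nonneg_right (mul_le_mul_of_nonneg_right ?_ (norm_nonneg _)) (norm_nonneg _)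
  exact Finset.single_le_sum (f := C) (fun k _ => hC k) (Finset.mem_range.2 k.2)

/-- The `i`-th unit vector in the first factor. -/
def unitLeft (i : Fin n) : Rn n × Rn n := (EuclideanSpace.single i 1, 0)

theorem slice_fderiv_apply {Φ : Rn n × Rn n → ℂ} (h : DerivBound (fun _ => 1) Φ) (ξ v : Rn n) :
    slice (h.fderiv_apply (v, 0)) ξ =
      ∑ i, ((v i : ℝ) : ℂ) • slice (h.fderiv_apply (unitLeft i)) ξ := by
  refine Subtype.ext (funext fun x => ?_)
  have hv : ((v, 0) : Rn n × Rn n) = ∑ i, v i • unitLeft i := by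
    have h1 := (EuclideanSpace.basisFun (Fin n) ℝ).sum_repr v
    refine Prod.ext ?_ ?_
    · simpa [unitLeft, Prod.fst_sum] using h1.symm
    · simp [unitLeft, Prod.snd_sum]
  rw [slice_apply, hv, map_sum]
  simp

theorem hasFDerivAt_jet_slice {Φ : Rn n × Rn n → ℂ} (h : DerivBound (fun _ => 1) Φ) (m : ℕ)
    (ξ : Rn n) : HasFDerivAt (fun ξ => B.jet m (slice h ξ))
      (∑ i, (EuclideanSpace.proj i : Rn n →L[ℝ] ℝ).smulRight
        (B.jet m (slice (h.fderiv_apply (unitLeft i)) ξ))) ξ := by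
  obtain ⟨C, hC, hb⟩ := norm_jet_slice_taylor_le h m
  rw [hasFDerivAt_iff_isLittleO_nhds_zero]
  have h1 : (fun v : Rn n => B.jet m (slice h (ξ + v)) - B.jet m (slice h ξ) -
      (∑ i, (EuclideanSpace.proj i : Rn n →L[ℝ] ℝ).smulRight
        (B.jet m (slice (h.fderiv_apply (unitLeft i)) ξ))) v) =O[𝓝 0] fun v => ‖v‖ ^ 2 := by
    refine Asymptotics.IsBigO.of_bound C (Eventually.of_forall fun v => ?_)
    have h2 : (∑ i, (EuclideanSpace.proj i : Rn n →L[ℝ] ℝ).smulRight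
        (B.jet m (slice (h.fderiv_apply (unitLeft i)) ξ))) v =
        B.jet m (slice (h.fderiv_apply (v, 0)) ξ) := by
      rw [slice_fderiv_apply h, map_sum]
      simp only [map_smul, sum_apply, ContinuousLinearMap.smulRight_apply, PiLp.proj_apply]
      rfl
    rw [h2]
    refine (hb ξ v).trans (le_of_eq ?_)
    rw [Real.norm_of_nonneg (by positivity)]
    ring
  refine h1.trans_isLittleO ?_
  simpa using (Asymptotics.isLittleO_norm_pow_id (E' := Rn n) (n := 2) (by norm_num))

/-- The value of a linear form on the slices `Φ(ξ, ·)`, as a function of `ξ`: its partial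
derivatives are the values at the slices of the partial derivatives. -/
theorem hasPartials_slice {Φ : Rn n × Rn n → ℂ} (h : DerivBound (fun _ => 1) Φ) {m : ℕ}
    (S : Jet n m →L[ℂ] ℂ) : HasPartials (fun ξ => S (B.jet m (slice h ξ)))
      (fun i ξ => S (B.jet m (slice (h.fderiv_apply (unitLeft i)) ξ))) := by
  intro ξ
  refine ((S.restrictScalars ℝ).hasFDerivAt.comp ξ (hasFDerivAt_jet_slice h m ξ)).congr_fderiv ?_
  ext v
  simp

end

section

/-! ### Limits of jets, integrals of jets and linear forms on jets -/

variable {n : ℕ}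

/-- The value at a point of the component of order zero. -/
def Jet.value {m : ℕ} (x : Rn n) : Jet n m →L[ℂ] ℂ :=
  LinearMap.mkContinuous
    { toFun := fun F => F 0 x (0 : Fin 0 → Rn n)
      map_add' := fun _ _ => rfl
      map_smul' := fun _ _ => rfl } 1 fun F => by
    have h := (F 0 x).le_opNorm 0
    have h1 : ∏ i, ‖(0 : Fin ((0 : Fin (m + 1)) : ℕ) → Rn n) i‖ = 1 := Finset.prod_empty
    rw [h1, mul_one] at h
    rw [one_mul]
    exact h.trans (F.norm_apply_le 0 x)

theorem Jet.value_jet {m : ℕ} (ψ : B n) (x : Rn n) :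
    Jet.value x (B.jet m ψ) = (ψ : Rn n → ℂ) x := rfl

theorem Jet.eq_zero_of_value_eq_zero {m : ℕ} {F : Jet n m} {x : Rn n} (h : Jet.value x F = 0) :
    F 0 x = 0 := by
  ext v
  have hv : v = (0 : Fin 0 → Rn n) := Subsingleton.elim (α := Fin 0 → Rn n) _ _
  rw [hv]
  exact h

/-- Uniform convergence of the derivatives passes the relation between consecutive components to the
limit: if component k vanishes, component k + 1 is the derivative of zero. -/
theorem Jet.eq_zero_of_mem_closure {m : ℕ} {F : Jet n m}
    (hF : F ∈ closure (Set.range (B.jet m : B n → Jet n m))) (h0 : ∀ x, F 0 x = 0) : F = 0 := by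
  obtain ⟨u, hu, hlim⟩ := mem_closure_iff_seq_limit.1 hF
  choose ψ hψ using hu
  have key : ∀ k (hk : k < m + 1), ∀ x, F ⟨k, hk⟩ x = 0 := by
    intro k
    induction k with
    | zero => exact fun hk x => h0 x
    | succ k ih =>
      intro hk x
      have hk' : k < m + 1 := by omega
      set Z := continuousMultilinearCurryLeftEquiv ℝ (fun _ : Fin (k + 1) => Rn n) ℂ with hZ
      set G : Rn n →ᵇ (Rn n [×(k + 1)]→L[ℝ] ℂ) := F ⟨k + 1, hk⟩
      have hnorm : ∀ ε > 0, ∀ᶠ i in atTop, ‖F - u i‖ < ε := by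
        intro ε hε
        filter_upwards [Metric.tendsto_nhds.1 hlim ε hε] with i hi
        rwa [← dist_eq_norm, dist_comm]
      have hunif : TendstoUniformly (fun i => fderiv ℝ (iteratedFDeriv ℝ k (ψ i : Rn n → ℂ)))
          (fun x => Z (G x)) atTop := by
        refine (Metric.tendstoUniformly_iff (α := Rn n →L[ℝ] Rn n [×k]→L[ℝ] ℂ)).2 fun ε hε => ?_
        filter_upwards [hnorm ε hε] with i hi x
        refine lt_of_le_of_lt ?_ hi
        rw [fderiv_iteratedFDeriv]
        refine ((Z.dist_map _ _).trans (dist_eq_norm _ _)).trans_le ?_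
        rw [← hψ i]
        exact (F - B.jet m (ψ i)).norm_apply_le ⟨k + 1, hk⟩ x
      have hd : ∀ i x, HasFDerivAt (iteratedFDeriv ℝ k (ψ i : Rn n → ℂ))
          (fderiv ℝ (iteratedFDeriv ℝ k (ψ i : Rn n → ℂ)) x) x := fun i x =>
        (((ψ i).2.1.iteratedFDeriv_right (m := ∞) (i := k)
          (by exact_mod_cast le_top)).differentiable (by simp) x).hasFDerivAt
      have hpt : ∀ x, Tendsto (fun i => iteratedFDeriv ℝ k (ψ i : Rn n → ℂ) x) atTop
          (𝓝 ((fun _ => 0) x)) := by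
        intro x
        have h1 := ((Jet.eval ⟨k, hk'⟩ x).continuous.tendsto F).comp hlim
        rw [Jet.eval_apply, ih hk' x] at h1
        refine h1.congr fun i => ?_
        simp only [Function.comp_apply, ← hψ i]
        rfl
      have h2 := hasFDerivAt_of_tendstoUniformly hunif hd hpt x
      have h3 := h2.unique (hasFDerivAt_const (0 : Rn n [×k]→L[ℝ] ℂ) x)
      exact (LinearIsometryEquiv.map_eq_zero_iff Z).1 h3
  funext k
  ext1 x
  exact key k k.2 x

/-- The quotient map by M kills the integrand and commutes with the integral. -/
theorem Submodule.integral_mem_of_isClosed {X E : Type*} [MeasurableSpace X] {ν : Measure X}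
    [NormedAddCommGroup E] [NormedSpace ℂ E] [CompleteSpace E] {M : Submodule ℂ E}
    (hM : IsClosed (M : Set E)) {f : X → E} (hf : Integrable f ν) (hmem : ∀ x, f x ∈ M) :
    ∫ x, f x ∂ν ∈ M := by
  -- Closedness is made available to instance search, where the norm on the quotient by M requires
  -- it.
  have := hM
  have h := (M.mkQL).integral_comp_comm hf
  have h0 : ∀ x, M.mkQL (f x) = 0 := fun x => (Submodule.Quotient.mk_eq_zero M).2 (hmem x)
  simp only [h0, integral_zero] at h
  exact (Submodule.Quotient.mk_eq_zero M).1 h.symm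

/-- Integrals of jets agree if they agree at order zero. -/
theorem Jet.integral_eq_integral {m : ℕ} {φ ψ : Rn n → B n}
    (hφ : Integrable fun ξ => B.jet m (φ ξ)) (hψ : Integrable fun ξ => B.jet m (ψ ξ))
    (h : ∀ x, ∫ ξ, (φ ξ : Rn n → ℂ) x = ∫ ξ, (ψ ξ : Rn n → ℂ) x) :
    ∫ ξ, B.jet m (φ ξ) = ∫ ξ, B.jet m (ψ ξ) := by
  have hmem : ∀ {χ : Rn n → B n}, Integrable (fun ξ => B.jet m (χ ξ)) →
      ∫ ξ, B.jet m (χ ξ) ∈ (LinearMap.range (B.jet (n := n) m)).topologicalClosure := fun hχ =>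
    Submodule.integral_mem_of_isClosed (Submodule.isClosed_topologicalClosure _) hχ
      fun x => Submodule.le_topologicalClosure _ ⟨_, rfl⟩
  rw [← sub_eq_zero]
  refine Jet.eq_zero_of_mem_closure ?_ fun x => ?_
  · have := sub_mem (hmem hφ) (hmem hψ)
    rwa [← SetLike.mem_coe, Submodule.topologicalClosure_coe, LinearMap.coe_range] at this
  · refine Jet.eq_zero_of_value_eq_zero ?_
    rw [map_sub, ← (Jet.value x).integral_comp_comm hφ, ← (Jet.value x).integral_comp_comm hψ]
    exact sub_eq_zero.2 (h x)

theorem B.jet_injective (m : ℕ) : Function.Injective (B.jet (n := n) m) := by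
  intro φ ψ h
  refine Subtype.ext (funext fun x => ?_)
  rw [← Jet.value_jet (m := m), h, Jet.value_jet]

/-- A linear form on `𝓑` that is bounded by the derivatives of order at most `m` is the
restriction of a continuous linear form on the space of jets. -/
theorem B.exists_jet_extension {m : ℕ} (S : B n →ₗ[ℂ] ℂ) {A : ℝ} (hA : 0 ≤ A)
    (hS : ∀ ψ, ‖S ψ‖ ≤ A * ‖B.jet m ψ‖) :
    ∃ L : Jet n m →L[ℂ] ℂ, ‖L‖ ≤ A ∧ ∀ ψ, L (B.jet m ψ) = S ψ := by
  set e := LinearEquiv.ofInjective (B.jet (n := n) m) (B.jet_injective m) with he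
  have hb : ∀ y, ‖(S ∘ₗ e.symm.toLinearMap) y‖ ≤ A * ‖y‖ := by
    intro y
    obtain ⟨ψ, rfl⟩ := e.surjective y
    rw [LinearMap.comp_apply, LinearEquiv.coe_toLinearMap, e.symm_apply_apply]
    exact hS ψ
  obtain ⟨L, hL, hn⟩ := exists_extension_norm_eq (𝕜 := ℂ) (LinearMap.range (B.jet (n := n) m))
    ((S ∘ₗ e.symm.toLinearMap).mkContinuous A hb)
  refine ⟨L, hn.trans_le (LinearMap.mkContinuous_norm_le _ hA _), fun ψ => ?_⟩
  refine (hL (e ψ)).trans ?_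
  rw [LinearMap.mkContinuous_apply, LinearMap.comp_apply, LinearEquiv.coe_toLinearMap,
    e.symm_apply_apply]

/-- Integrability of the values of a linear form, by duality from bounds that are pointwise in the
second variable. -/
theorem Jet.integrable_dual {m : ℕ} (S : Jet n m →L[ℂ] ℂ) {F : Rn n → Jet n m} (hF : Continuous F)
    {M : ℝ} (hM : ∀ k x, Integrable (fun ξ => F ξ k x) ∧ ∫ ξ, ‖F ξ k x‖ ≤ M) :
    Integrable (fun ξ => S (F ξ)) ∧ ∫ ξ, ‖S (F ξ)‖ ≤ ‖S‖ * M := by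
  have hM0 : 0 ≤ M := (integral_nonneg fun ξ => norm_nonneg _).trans (hM 0 0).2
  have hSF : Continuous fun ξ => S (F ξ) := S.continuous.comp hF
  -- The phase that turns S(F ξ) into its absolute value; it is 0 where S(F ξ) = 0, because the
  -- inverse of 0 is 0.
  set θ : Rn n → ℂ := fun ξ => (starRingEnd ℂ (S (F ξ))) * ((‖S (F ξ)‖⁻¹ : ℝ) : ℂ) with hθ
  have hθ1 : ∀ ξ, ‖θ ξ‖ ≤ 1 := by
    intro ξ
    simp only [hθ, norm_mul, RCLike.norm_conj, Complex.norm_real, norm_inv, norm_norm]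
    exact mul_inv_le_one
  have hθS : ∀ ξ, θ ξ * S (F ξ) = (‖S (F ξ)‖ : ℂ) := by
    intro ξ
    by_cases h : S (F ξ) = 0
    · simp [hθ, h]
    · have h1 : (‖S (F ξ)‖ : ℂ) ≠ 0 := by simpa using h
      have h2 := Complex.conj_mul' (S (F ξ))
      simp only [hθ, Complex.ofReal_inv]
      field_simp
      linear_combination h2
  have hθm : Measurable θ :=
    (Complex.continuous_conj.measurable.comp hSF.measurable).mul
      (Complex.measurable_ofReal.comp hSF.norm.measurable.inv)
  have hcov : AECover (volume : Measure (Rn n)) atTop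
      fun j : ℕ => Metric.closedBall (0 : Rn n) j := aecover_closedBall tendsto_natCast_atTop_atTop
  -- F is not assumed norm integrable, so the Bochner integral of θF is formed on balls only; the
  -- bound ‖S‖ M does not depend on the ball.
  have hball : ∀ j : ℕ, ∫ ξ in Metric.closedBall (0 : Rn n) j, ‖S (F ξ)‖ ≤ ‖S‖ * M := by
    intro j
    have hFi : IntegrableOn F (Metric.closedBall (0 : Rn n) j) :=
      hF.continuousOn.integrableOn_compact (isCompact_closedBall _ _)
    have hθF : IntegrableOn (fun ξ => θ ξ • F ξ) (Metric.closedBall (0 : Rn n) j) := by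
      refine Integrable.mono hFi (hθm.aestronglyMeasurable.smul hFi.aestronglyMeasurable)
        (Eventually.of_forall fun ξ => ?_)
      rw [norm_smul]
      exact mul_le_of_le_one_left (norm_nonneg _) (hθ1 ξ)
    have h1 : ((∫ ξ in Metric.closedBall (0 : Rn n) j, ‖S (F ξ)‖ : ℝ) : ℂ) =
        S (∫ ξ in Metric.closedBall (0 : Rn n) j, θ ξ • F ξ) := by
      rw [← S.integral_comp_comm hθF, ← integral_complex_ofReal]
      refine integral_congr_ae (Eventually.of_forall fun ξ => ?_)
      simp only [map_smul, smul_eq_mul, hθS]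
    have h2 : ‖∫ ξ in Metric.closedBall (0 : Rn n) j, θ ξ • F ξ‖ ≤ M := by
      refine (Jet.norm_le_iff hM0).2 fun k x => ?_
      rw [← Jet.eval_apply, ← (Jet.eval k x).integral_comp_comm hθF]
      refine (norm_integral_le_integral_norm _).trans ?_
      refine le_trans ?_ (hM k x).2
      refine le_trans ?_ (setIntegral_le_integral (s := Metric.closedBall (0 : Rn n) j) (hM k x).1.norm
        (Eventually.of_forall fun ξ => norm_nonneg _))
      refine integral_mono ((Jet.eval k x).integrable_comp hθF).norm
        (hM k x).1.norm.integrableOn fun ξ => ?_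
      simp only [map_smul, norm_smul, Jet.eval_apply]
      exact mul_le_of_le_one_left (norm_nonneg _) (hθ1 ξ)
    have h3 : ∫ ξ in Metric.closedBall (0 : Rn n) j, ‖S (F ξ)‖ =
        ‖((∫ ξ in Metric.closedBall (0 : Rn n) j, ‖S (F ξ)‖ : ℝ) : ℂ)‖ := by
      rw [Complex.norm_real, Real.norm_of_nonneg (integral_nonneg fun ξ => norm_nonneg _)]
    rw [h3, h1]
    exact (S.le_opNorm _).trans (mul_le_mul_of_nonneg_left h2 (norm_nonneg _))
  have hint : Integrable fun ξ => S (F ξ) :=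
    hcov.integrable_of_integral_norm_bounded (‖S‖ * M)
      (fun j => hSF.continuousOn.integrableOn_compact (isCompact_closedBall _ _))
      (Eventually.of_forall hball)
  exact ⟨hint, le_of_tendsto (hcov.integral_tendsto_of_countably_generated hint.norm)
    (Eventually.of_forall hball)⟩

end

section

/-! ### Products and cutoff functions -/

variable {n : ℕ}

/-- Multiplication by an element of `𝓑`. -/
def B.mul (χ : B n) : B n →ₗ[ℂ] B n where
  toFun ψ := ⟨fun x => (χ : Rn n → ℂ) x * (ψ : Rn n → ℂ) x,
    ((B.derivBound χ).mul (B.derivBound ψ)).mem_B (c := 1) fun x => by simp⟩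
  map_add' f g := Subtype.ext (funext fun x => mul_add _ _ _)
  map_smul' c f := Subtype.ext (funext fun x => mul_left_comm _ _ _)

@[simp] theorem B.mul_apply (χ ψ : B n) (x : Rn n) :
    (B.mul χ ψ : Rn n → ℂ) x = (χ : Rn n → ℂ) x * (ψ : Rn n → ℂ) x := rfl

theorem B.norm_jet_mul_le (m : ℕ) (χ ψ : B n) :
    ‖B.jet m (B.mul χ ψ)‖ ≤ 2 ^ m * ‖B.jet m χ‖ * ‖B.jet m ψ‖ := by
  refine B.norm_jet_le (by positivity) fun k hk x => ?_
  refine (norm_iteratedFDeriv_mul_le χ.2.1 ψ.2.1 x (n := k) (by exact_mod_cast le_top)).trans ?_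
  have h1 : ∀ i ∈ Finset.range (k + 1), (k.choose i : ℝ) *
      ‖iteratedFDeriv ℝ i (χ : Rn n → ℂ) x‖ * ‖iteratedFDeriv ℝ (k - i) (ψ : Rn n → ℂ) x‖ ≤
      (k.choose i : ℝ) * (‖B.jet m χ‖ * ‖B.jet m ψ‖) := by
    intro i hi
    rw [mul_assoc]
    have hi' := Finset.mem_range.1 hi
    exact mul_le_mul_of_nonneg_left (mul_le_mul (B.norm_iteratedFDeriv_le_jet χ (by omega) x)
      (B.norm_iteratedFDeriv_le_jet ψ (by omega) x) (norm_nonneg _) (norm_nonneg _)) (by positivity)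
  refine (Finset.sum_le_sum h1).trans ?_
  rw [← Finset.sum_mul, mul_assoc]
  refine mul_le_mul_of_nonneg_right ?_ (by positivity)
  have h2 := Nat.sum_range_choose k
  have h3 : ∑ i ∈ Finset.range (k + 1), (k.choose i : ℝ) = 2 ^ k := by exact_mod_cast h2
  rw [h3]
  exact pow_le_pow_right₀ one_le_two hk

theorem B.mem_BDotSub_of_hasCompactSupport {ψ : B n}
    (h : HasCompactSupport (ψ : Rn n → ℂ)) : ψ ∈ BDotSub n := by
  intro k
  refine tendsto_const_nhds.congr' ?_
  filter_upwards [(h.iteratedFDeriv (𝕜 := ℝ) k).isCompact.compl_mem_cocompact] with x hx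
  exact (image_eq_zero_of_notMem_tsupport hx).symm

/-- A smooth bump function that is `1` on the unit ball. -/
def bump (n : ℕ) : ContDiffBump (0 : Rn n) := ⟨1, 2, zero_lt_one, one_lt_two⟩

theorem derivBound_bump : DerivBound (fun _ => 1) (fun x : Rn n => (bump n x : ℂ)) := by
  have hs : HasCompactSupport fun x : Rn n => (bump n x : ℂ) :=
    (bump n).hasCompactSupport.comp_left (g := Complex.ofReal) Complex.ofReal_zero
  have hd : ContDiff ℝ ∞ fun x : Rn n => (bump n x : ℂ) :=
    Complex.ofRealCLM.contDiff.comp (bump n).contDiff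
  refine ⟨hd, fun k => ?_⟩
  obtain ⟨C, hC⟩ := (hs.iteratedFDeriv (𝕜 := ℝ) k).exists_bound_of_continuous
    (hd.continuous_iteratedFDeriv (by exact_mod_cast le_top))
  exact ⟨C, (norm_nonneg _).trans (hC 0), fun p => by simpa using hC p⟩

/-- The cutoff function that is `1` on the ball of radius `j + 1`. -/
def cutoff (n j : ℕ) : B n :=
  ⟨fun x => (bump n ((((j : ℝ) + 1)⁻¹ • ContinuousLinearMap.id ℝ (Rn n)) x) : ℂ),
    (derivBound_bump.comp_clm _).mem_B (c := 1) fun _ => le_rfl⟩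

theorem cutoff_apply (j : ℕ) (x : Rn n) :
    (cutoff n j : Rn n → ℂ) x = (bump n (((j : ℝ) + 1)⁻¹ • x) : ℂ) := rfl

theorem cutoff_eq_one {j : ℕ} {x : Rn n} (hx : ‖x‖ ≤ j + 1) : (cutoff n j : Rn n → ℂ) x = 1 := by
  rw [cutoff_apply, (bump n).one_of_mem_closedBall, Complex.ofReal_one]
  rw [mem_closedBall_zero_iff, norm_smul, norm_inv, Real.norm_of_nonneg (by positivity)]
  exact inv_mul_le_one_of_le₀ hx (by positivity)

theorem hasCompactSupport_cutoff (j : ℕ) : HasCompactSupport (cutoff n j : Rn n → ℂ) := by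
  have hs : HasCompactSupport fun x : Rn n => (bump n x : ℂ) :=
    (bump n).hasCompactSupport.comp_left (g := Complex.ofReal) Complex.ofReal_zero
  exact hs.comp_smul (c := ((j : ℝ) + 1)⁻¹) (by positivity)

/-- Dilation by the factor 1/(j + 1) ≤ 1 can only shrink derivatives, so the bounds for the single
bump serve every j. -/
theorem norm_jet_cutoff_le (n m : ℕ) : ∃ C, 0 ≤ C ∧ ∀ j, ‖B.jet m (cutoff n j)‖ ≤ C := by
  choose C hC hb using (derivBound_bump (n := n)).2
  have h0 : 0 ≤ ∑ k ∈ Finset.range (m + 1), C k := Finset.sum_nonneg fun k _ => hC k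
  refine ⟨_, h0, fun j => B.norm_jet_le h0 fun k hk x => ?_⟩
  have hL : ‖((j : ℝ) + 1)⁻¹ • ContinuousLinearMap.id ℝ (Rn n)‖ ≤ 1 := by
    rw [norm_smul, norm_inv, Real.norm_of_nonneg (by positivity)]
    refine mul_le_one₀ (inv_le_one_of_one_le₀ (by linarith [j.cast_nonneg (α := ℝ)]))
      (norm_nonneg _) ContinuousLinearMap.norm_id_le
  refine (norm_iteratedFDeriv_comp_clm_le derivBound_bump.1 _ k x).trans ?_
  refine (mul_le_of_le_one_right (norm_nonneg _) (pow_le_one₀ (norm_nonneg _) hL)).trans ?_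
  refine (hb k _).trans ?_
  rw [mul_one]
  exact Finset.single_le_sum (f := C) (fun k _ => hC k) (Finset.mem_range.2 (by omega))

/-- Multiplication by a cutoff function maps `𝓑` to `𝓑̇`. -/
def cutDot (n j : ℕ) : B n →ₗ[ℂ] BDot n :=
  LinearMap.codRestrict (BDotSub n) (B.mul (cutoff n j)) fun _ =>
    B.mem_BDotSub_of_hasCompactSupport ((hasCompactSupport_cutoff j).mul_right)

theorem toB_cutDot (j : ℕ) (ψ : B n) : BDot.toB (cutDot n j ψ) = B.mul (cutoff n j) ψ := rfl

/-! ### The dual of `𝓑̇` -/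

theorem BDot.withSeminorms (n : ℕ) : WithSeminorms (BDot.seminorms n) := ⟨rfl⟩

theorem BDot.exists_bound (T : BDot n →L[ℂ] ℂ) :
    ∃ (m : ℕ) (A : ℝ), 0 ≤ A ∧ ∀ ψ, ‖T ψ‖ ≤ A * ‖B.jet m (BDot.toB ψ)‖ := by
  obtain ⟨s, C, -, h⟩ := Seminorm.bound_of_continuous (BDot.withSeminorms n)
    ((normSeminorm ℂ ℂ).comp T.toLinearMap) (continuous_norm.comp T.continuous)
  -- Continuity gives a bound by finitely many seminorms; the jet up to the largest order that
  -- occurs dominates them all.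
  refine ⟨s.sup id, C, C.2, fun ψ => (h ψ).trans ?_⟩
  refine mul_le_mul_of_nonneg_left ?_ C.2
  refine Seminorm.finset_sup_apply_le (norm_nonneg _) fun k hk => ?_
  refine (BoundedContinuousFunction.norm_le (norm_nonneg _)).2 fun x => ?_
  exact B.norm_iteratedFDeriv_le_jet (BDot.toB ψ) (Finset.le_sup (f := id) hk) x

/-- The factor c rotates b to the argument of a. -/
theorem Complex.exists_norm_add_mul_eq (a b : ℂ) : ∃ c : ℂ, ‖c‖ = 1 ∧ ‖a + c * b‖ = ‖a‖ + ‖b‖ := by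
  refine ⟨Complex.exp ((a.arg - b.arg : ℝ) * Complex.I), Complex.norm_exp_ofReal_mul_I _, ?_⟩
  have h1 : a + Complex.exp ((a.arg - b.arg : ℝ) * Complex.I) * b =
      ((‖a‖ + ‖b‖ : ℝ) : ℂ) * Complex.exp (a.arg * Complex.I) := by
    have h2 : Complex.exp ((a.arg - b.arg : ℝ) * Complex.I) * Complex.exp (b.arg * Complex.I) =
        Complex.exp (a.arg * Complex.I) := by
      rw [← Complex.exp_add]
      congr 1
      push_cast
      ring
    have ha := Complex.norm_mul_exp_arg_mul_I a
    have hb := Complex.norm_mul_exp_arg_mul_I b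
    calc _ = (‖a‖ : ℂ) * Complex.exp (a.arg * Complex.I) +
        Complex.exp ((a.arg - b.arg : ℝ) * Complex.I) *
          ((‖b‖ : ℂ) * Complex.exp (b.arg * Complex.I)) := by rw [ha, hb]
      _ = _ := by
        rw [mul_left_comm, h2]
        push_cast
        ring
  rw [h1, norm_mul, Complex.norm_exp_ofReal_mul_I, mul_one, Complex.norm_real,
    Real.norm_of_nonneg (by positivity)]

/-- The elements of the dual of `𝓑̇` are small on functions supported far away. -/
theorem BDot.tight {T : BDot n →L[ℂ] ℂ} {m : ℕ} {A : ℝ}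
    (hT : ∀ ψ, ‖T ψ‖ ≤ A * ‖B.jet m (BDot.toB ψ)‖) {ε : ℝ} (hε : 0 < ε) :
    ∃ R : ℝ, ∀ ψ : BDot n, (∀ x, ‖x‖ < R → (BDot.toB ψ : Rn n → ℂ) x = 0) →
      ‖T ψ‖ ≤ ε * ‖B.jet m (BDot.toB ψ)‖ := by
  set p : BDot n → ℝ := fun ψ => ‖B.jet m (BDot.toB ψ)‖ with hp
  have p_smul : ∀ (c : ℂ) ψ, p (c • ψ) = ‖c‖ * p ψ := fun c ψ => by
    simp only [hp, map_smul, norm_smul]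
  have hp0 : ∀ ψ, 0 ≤ p ψ := fun ψ => norm_nonneg _
  have hT' : ∀ ψ, ‖T ψ‖ ≤ A * p ψ := hT
  -- By homogeneity, bounds on p ψ ≤ 1 suffice; where p vanishes, so does T.
  have scale : ∀ {D : ℝ} {P : BDot n → Prop}, (∀ (c : ℂ) ψ, P ψ → P (c • ψ)) →
      (∀ ψ, P ψ → p ψ ≤ 1 → ‖T ψ‖ ≤ D) → ∀ ψ, P ψ → ‖T ψ‖ ≤ D * p ψ := by
    intro D P hP hD ψ hψ
    rcases (hp0 ψ).eq_or_lt with h | h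
    · have := hT' ψ
      rw [← h, mul_zero] at this
      rwa [← h, mul_zero]
    · have hc : ‖(((p ψ)⁻¹ : ℝ) : ℂ)‖ = (p ψ)⁻¹ := by
        rw [Complex.norm_real, Real.norm_of_nonneg (inv_nonneg.2 h.le)]
      have h1 := hD ((((p ψ)⁻¹ : ℝ) : ℂ) • ψ) (hP _ _ hψ)
        (by rw [p_smul, hc, inv_mul_cancel₀ h.ne'])
      rw [map_smul, norm_smul, hc, inv_mul_le_iff₀ h] at h1
      linarith
  -- N is the norm of T. A near-maximizer ψ₀ almost exhausts it, so a function ψ living where ψ₀ is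
  -- small can add little: |T ψ₀| + |T ψ| ≤ N(1 + δ) with |T ψ₀| > N - δ.
  set N : ℝ := sSup ((fun ψ => ‖T ψ‖) '' {ψ | p ψ ≤ 1}) with hNdef
  have hbdd : BddAbove ((fun ψ => ‖T ψ‖) '' {ψ | p ψ ≤ 1}) := by
    refine ⟨|A|, ?_⟩
    rintro _ ⟨ψ, hψ, rfl⟩
    refine (hT' ψ).trans ?_
    calc A * p ψ ≤ |A| * 1 := mul_le_mul (le_abs_self A) hψ (hp0 ψ) (abs_nonneg A)
      _ = |A| := mul_one _
  have hne : ((fun ψ => ‖T ψ‖) '' {ψ | p ψ ≤ 1}).Nonempty :=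
    ⟨_, 0, by simp [hp], rfl⟩
  have hN1 : ∀ ψ, p ψ ≤ 1 → ‖T ψ‖ ≤ N := fun ψ hψ => le_csSup hbdd ⟨ψ, hψ, rfl⟩
  have hN : ∀ ψ, ‖T ψ‖ ≤ N * p ψ := fun ψ =>
    scale (P := fun _ => True) (fun _ _ _ => trivial) (fun ψ _ h => hN1 ψ h) ψ trivial
  have hN0 : 0 ≤ N := (norm_nonneg _).trans (hN1 0 (by simp [hp]))
  -- Chosen so that N(1 + δ) - (N - δ) = δ(N + 1) = ε.
  set δ : ℝ := ε / (N + 1) with hδ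
  have hδ0 : 0 < δ := by positivity
  have hδε : δ * (N + 1) = ε := div_mul_cancel₀ _ (by positivity)
  obtain ⟨_, ⟨ψ₀, hψ₀, rfl⟩, hlt⟩ := exists_lt_of_lt_csSup hne (sub_lt_self N hδ0)
  have hev : ∀ᶠ x in cocompact (Rn n), ∀ k ∈ Finset.range (m + 1),
      ‖iteratedFDeriv ℝ k (BDot.toB ψ₀ : Rn n → ℂ) x‖ < δ := by
    rw [Filter.eventually_all_finset]
    intro k _
    have h1 := (ψ₀.2 k).norm
    rw [norm_zero] at h1
    exact h1.eventually (gt_mem_nhds hδ0)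
  obtain ⟨t, ht, hts⟩ := mem_cocompact.1 hev
  obtain ⟨r, hr⟩ := ht.isBounded.subset_closedBall (0 : Rn n)
  refine ⟨r + 1, scale (P := fun ψ => ∀ x, ‖x‖ < r + 1 → (BDot.toB ψ : Rn n → ℂ) x = 0)
    (fun c ψ h x hx => ?_) fun ψ hψ hψ1 => ?_⟩
  · have : (BDot.toB (c • ψ) : Rn n → ℂ) x = c * (BDot.toB ψ : Rn n → ℂ) x := rfl
    rw [this, h x hx, mul_zero]
  · obtain ⟨c, hc, hcadd⟩ := Complex.exists_norm_add_mul_eq (T ψ₀) (T ψ)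
    have hsum : p (ψ₀ + c • ψ) ≤ 1 + δ := by
      refine B.norm_jet_le (by positivity) fun k hk x => ?_
      have hadd : iteratedFDeriv ℝ k (BDot.toB (ψ₀ + c • ψ) : Rn n → ℂ) x =
          iteratedFDeriv ℝ k (BDot.toB ψ₀ : Rn n → ℂ) x +
          c • iteratedFDeriv ℝ k (BDot.toB ψ : Rn n → ℂ) x := by
        rw [← B.deriv_apply, ← B.deriv_apply, ← B.deriv_apply, map_add, map_smul, map_add, map_smul]
        rfl
      rw [hadd]
      refine (norm_add_le _ _).trans ?_
      rw [norm_smul, hc, one_mul]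
      have h0 := (B.norm_iteratedFDeriv_le_jet (BDot.toB ψ₀) hk x).trans hψ₀
      have h1 := (B.norm_iteratedFDeriv_le_jet (BDot.toB ψ) hk x).trans hψ1
      -- At each x one summand is negligible: inside the open ball ψ vanishes near x together with
      -- its derivatives, and outside it those of ψ₀ are below δ.
      rcases lt_or_ge ‖x‖ (r + 1) with hx | hx
      · have hz : (BDot.toB ψ : Rn n → ℂ) =ᶠ[𝓝 x] (0 : Rn n → ℂ) := by
          filter_upwards [(isOpen_lt continuous_norm continuous_const).mem_nhds hx] with y hy
          exact hψ y hy
        have hz' := (hz.iteratedFDeriv ℝ k).eq_of_nhds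
        rw [hz', iteratedFDeriv_zero]
        simp only [Pi.zero_apply, norm_zero, add_zero]
        linarith
      · have hxt : x ∉ t := fun h => by
          have := mem_closedBall_zero_iff.1 (hr h)
          linarith
        have h2 := hts hxt k (Finset.mem_range.2 (by omega))
        linarith
    have h3 := hN (ψ₀ + c • ψ)
    rw [map_add, map_smul, smul_eq_mul, hcadd] at h3
    have h4 := h3.trans (mul_le_mul_of_nonneg_left hsum hN0)
    simp only at hlt
    nlinarith

/-- The extension of an element of the dual of `𝓑̇` to `𝓑`, as the limit of its values on the
products with the cutoff functions. -/
theorem BDot.exists_extension (T : BDot n →L[ℂ] ℂ) :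
    ∃ (m : ℕ) (A : ℝ) (U : B n →ₗ[ℂ] ℂ), 0 ≤ A ∧ (∀ ψ, U (BDot.toB ψ) = T ψ) ∧
      (∀ ψ, ‖U ψ‖ ≤ A * ‖B.jet m ψ‖) ∧
      ∀ ε > 0, ∃ J, ∀ j ≥ J, ∀ ψ, ‖U ψ - U (B.mul (cutoff n j) ψ)‖ ≤ ε * ‖B.jet m ψ‖ := by
  obtain ⟨m, A, hA, hT⟩ := BDot.exists_bound T
  obtain ⟨K, hK, hcut⟩ := norm_jet_cutoff_le n m
  set L : ℝ := 2 ^ m * K with hL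
  have hL0 : 0 ≤ L := by positivity
  have hmul : ∀ j ψ, ‖B.jet m (B.mul (cutoff n j) ψ)‖ ≤ L * ‖B.jet m ψ‖ := fun j ψ =>
    (B.norm_jet_mul_le m _ _).trans (mul_le_mul_of_nonneg_right
      (mul_le_mul_of_nonneg_left (hcut j) (by positivity)) (norm_nonneg _))
  have hcauchy : ∀ ε > 0, ∃ J, ∀ i ≥ J, ∀ j ≥ J, ∀ ψ,
      ‖T (cutDot n i ψ) - T (cutDot n j ψ)‖ ≤ ε * ‖B.jet m ψ‖ := by
    intro ε hε
    -- The difference of two cut-off copies of ψ vanishes on a large ball and has jet norm at most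
    -- 2L times that of ψ; the added 1 keeps the denominator positive.
    obtain ⟨R, hR⟩ := BDot.tight hT (ε := ε / (2 * L + 1)) (by positivity)
    obtain ⟨J, hJ⟩ := exists_nat_ge R
    refine ⟨J, fun i hi j hj ψ => ?_⟩
    rw [← map_sub]
    have h1 : ∀ l ≥ J, ∀ x : Rn n, ‖x‖ < R → (cutoff n l : Rn n → ℂ) x = 1 := fun l hl x hx =>
      cutoff_eq_one (by
        have : (J : ℝ) ≤ l := by exact_mod_cast hl
        linarith)
    refine (hR _ fun x hx => ?_).trans ?_
    · rw [map_sub, toB_cutDot, toB_cutDot]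
      calc _ = (cutoff n i : Rn n → ℂ) x * (ψ : Rn n → ℂ) x -
          (cutoff n j : Rn n → ℂ) x * (ψ : Rn n → ℂ) x := rfl
        _ = 0 := by rw [h1 i hi x hx, h1 j hj x hx, sub_self]
    · rw [map_sub, map_sub, toB_cutDot, toB_cutDot, div_mul_eq_mul_div, div_le_iff₀ (by positivity),
        mul_assoc]
      refine mul_le_mul_of_nonneg_left ((norm_sub_le _ _).trans ?_) hε.le
      have := hmul i ψ
      have := hmul j ψ
      nlinarith [norm_nonneg (B.jet m ψ)]
  have hlim : ∀ ψ, ∃ u, Tendsto (fun j => T (cutDot n j ψ)) atTop (𝓝 u) := by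
    intro ψ
    refine cauchySeq_tendsto_of_complete (Metric.cauchySeq_iff.2 fun ε hε => ?_)
    obtain ⟨J, hJ⟩ := hcauchy (ε / (‖B.jet m ψ‖ + 1)) (by positivity)
    refine ⟨J, fun i hi j hj => ?_⟩
    rw [dist_eq_norm]
    refine (hJ i hi j hj ψ).trans_lt ?_
    rw [div_mul_eq_mul_div, div_lt_iff₀ (by positivity)]
    exact mul_lt_mul_of_pos_left (by linarith) hε
  choose u hu using hlim
  set U : B n →ₗ[ℂ] ℂ := linearMapOfTendsto u (fun j => T.toLinearMap ∘ₗ cutDot n j)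
    (tendsto_pi_nhds.2 hu) with hU
  have hUlim : ∀ ψ, Tendsto (fun j => T (cutDot n j ψ)) atTop (𝓝 (U ψ)) := hu
  have hext : ∀ ψ, U (BDot.toB ψ) = T ψ := by
    intro ψ
    refine tendsto_nhds_unique (hUlim _) (Metric.tendsto_atTop.2 fun ε hε => ?_)
    set P : ℝ := (1 + L) * ‖B.jet m (BDot.toB ψ)‖ + 1 with hP
    have hP0 : 0 < P := by positivity
    obtain ⟨R, hR⟩ := BDot.tight hT (ε := ε / P) (by positivity)
    obtain ⟨J, hJ⟩ := exists_nat_ge R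
    refine ⟨J, fun j hj => ?_⟩
    have hj' : (J : ℝ) ≤ j := by exact_mod_cast hj
    rw [dist_eq_norm, ← map_sub]
    refine (hR _ fun x hx => ?_).trans_lt ?_
    · rw [map_sub, toB_cutDot]
      calc _ = (cutoff n j : Rn n → ℂ) x * (BDot.toB ψ : Rn n → ℂ) x -
          (BDot.toB ψ : Rn n → ℂ) x := rfl
        _ = 0 := by rw [cutoff_eq_one (by linarith), one_mul, sub_self]
    · rw [map_sub, map_sub, toB_cutDot, div_mul_eq_mul_div, div_lt_iff₀ hP0]
      refine mul_lt_mul_of_pos_left ((norm_sub_le _ _).trans_lt ?_) hε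
      have := hmul j (BDot.toB ψ)
      rw [hP]
      linarith
  refine ⟨m, A * L, U, by positivity, hext, fun ψ => ?_, fun ε hε => ?_⟩
  · refine le_of_tendsto (hUlim ψ).norm (Eventually.of_forall fun j => (hT _).trans ?_)
    rw [toB_cutDot, mul_assoc]
    exact mul_le_mul_of_nonneg_left (hmul j ψ) hA
  · obtain ⟨J, hJ⟩ := hcauchy ε hε
    refine ⟨J, fun j hj ψ => ?_⟩
    rw [← toB_cutDot, hext]
    refine le_of_tendsto ((hUlim ψ).sub_const _).norm ?_
    filter_upwards [eventually_ge_atTop J] with i hi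
    exact hJ i hi j hj ψ

end

section

/-! ### Integrable functions as linear forms on `𝓑̇` and `𝓑_c` -/

variable {n : ℕ}

theorem B.norm_le_deriv_zero (ψ : B n) (x : Rn n) : ‖(ψ : Rn n → ℂ) x‖ ≤ ‖B.deriv 0 ψ‖ := by
  have h := (B.deriv 0 ψ).norm_coe_le_norm x
  rwa [B.deriv_apply, norm_iteratedFDeriv_zero] at h

theorem B.continuous (ψ : B n) : Continuous (ψ : Rn n → ℂ) := ψ.2.1.continuous

theorem B.integrable_mul (ψ : B n) {q : Rn n → ℂ} (hq : Integrable q) :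
    Integrable fun x => (ψ : Rn n → ℂ) x * q x :=
  hq.bdd_mul (B.continuous ψ).aestronglyMeasurable
    (Eventually.of_forall (B.norm_le_deriv_zero ψ))

/-- Integration against an integrable function, as a linear form on `𝓑`. -/
def integralForm {q : Rn n → ℂ} (hq : Integrable q) : B n →ₗ[ℂ] ℂ where
  toFun ψ := ∫ x, (ψ : Rn n → ℂ) x * q x
  map_add' f g := by
    rw [← integral_add (B.integrable_mul f hq) (B.integrable_mul g hq)]
    exact integral_congr_ae (Eventually.of_forall fun x => add_mul _ _ _)
  map_smul' c f := by
    rw [RingHom.id_apply, smul_eq_mul, ← integral_const_mul]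
    exact integral_congr_ae (Eventually.of_forall fun x => mul_assoc _ _ _)

theorem integralForm_apply {q : Rn n → ℂ} (hq : Integrable q) (ψ : B n) :
    integralForm hq ψ = ∫ x, (ψ : Rn n → ℂ) x * q x := rfl

/-- Integration against an integrable function, as an element of the dual of `𝓑̇`. -/
def integralDot {q : Rn n → ℂ} (hq : Integrable q) : BDot n →L[ℂ] ℂ :=
  ⟨integralForm hq ∘ₗ BDot.toB, by
    refine WithSeminorms.continuous_normedSpace_rng ℂ (BDot.withSeminorms n) _
      ⟨{0}, (∫ x, ‖q x‖).toNNReal, fun ψ => ?_⟩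
    have h0 : 0 ≤ ∫ x, ‖q x‖ := integral_nonneg fun x => norm_nonneg _
    rw [Finset.sup_singleton]
    change ‖∫ x, (BDot.toB ψ : Rn n → ℂ) x * q x‖ ≤
      ((∫ x, ‖q x‖).toNNReal : ℝ) * ‖B.deriv 0 (BDot.toB ψ)‖
    rw [Real.coe_toNNReal _ h0, mul_comm, ← integral_const_mul]
    refine (norm_integral_le_integral_norm _).trans
      (integral_mono (B.integrable_mul _ hq).norm (hq.norm.const_mul _) fun x => ?_)
    simp only [norm_mul]
    exact mul_le_mul_of_nonneg_right (B.norm_le_deriv_zero _ x) (norm_nonneg _)⟩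

/-- Outside a large ball q has little mass and the functions of S are uniformly bounded; on the
ball, convergence in C^∞ is uniform. -/
theorem integralForm_continuous_on_bdd {q : Rn n → ℂ} (hq : Integrable q) {S : Set (B n)}
    (hS : B.IsBddSet S) :
    Continuous[TopologicalSpace.induced (fun φ : S => (φ : B n)) (B.smoothTopology n), _]
      (fun φ : S => integralForm hq (φ : B n)) := by
  let tB : TopologicalSpace (B n) := B.smoothTopology n
  let tS : TopologicalSpace S := TopologicalSpace.induced (fun φ : S => (φ : B n)) tB
  have hc : Continuous fun φ : S => (B.deriv 0 (φ : B n)).toContinuousMap := by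
    have h1 : Continuous fun φ : B n => (B.deriv 0 φ).toContinuousMap :=
      continuous_iInf_dom (i := 0) continuous_induced_dom
    exact h1.comp continuous_induced_dom
  obtain ⟨C, hC⟩ := hS 0
  refine continuous_iff_continuousAt.2 fun φ₀ => Metric.tendsto_nhds.2 fun ε hε => ?_
  have hC0 : 0 ≤ C := (norm_nonneg (B.deriv 0 (φ₀ : B n))).trans (hC φ₀ φ₀.2)
  set Q : ℝ := ∫ x, ‖q x‖ with hQ
  have hQ0 : 0 ≤ Q := integral_nonneg fun x => norm_nonneg _
  have hcov : AECover (volume : Measure (Rn n)) atTop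
      fun j : ℕ => Metric.closedBall (0 : Rn n) j := aecover_closedBall tendsto_natCast_atTop_atTop
  obtain ⟨j, hj⟩ := ((hcov.integral_tendsto_of_countably_generated hq.norm).eventually
    (lt_mem_nhds (sub_lt_self Q (show 0 < ε / (2 * (2 * C + 1)) by positivity)))).exists
  set K : Set (Rn n) := Metric.closedBall 0 j with hK
  have hKm : MeasurableSet K := Metric.isClosed_closedBall.measurableSet
  have hout : ∫ x in Kᶜ, ‖q x‖ < ε / (2 * (2 * C + 1)) := by
    have := integral_add_compl hKm hq.norm
    linarith
  have hunif := (ContinuousMap.tendsto_iff_forall_isCompact_tendstoUniformlyOn.1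
    (hc.tendsto φ₀)) K (isCompact_closedBall _ _)
  filter_upwards [(Metric.tendstoUniformlyOn_iff.1 hunif) (ε / (2 * (Q + 1))) (by positivity)]
    with φ hφ
  set δ : ℝ := ε / (2 * (Q + 1)) with hδ
  have hδ0 : 0 < δ := by positivity
  have hin : ∀ x ∈ K, ‖(φ : B n).1 x - (φ₀ : B n).1 x‖ ≤ δ := by
    intro x hx
    have h1 := hφ x hx
    have h2 : dist ((B.deriv 0 (φ₀ : B n)).toContinuousMap x)
        ((B.deriv 0 (φ : B n)).toContinuousMap x) =
        ‖iteratedFDeriv ℝ 0 ((φ₀ : B n) - (φ : B n) : B n).1 x‖ := by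
      rw [← B.deriv_apply, map_sub]
      exact dist_eq_norm _ _
    rw [h2, norm_iteratedFDeriv_zero] at h1
    rw [norm_sub_rev]
    exact h1.le
  have hall : ∀ x, ‖(φ : B n).1 x - (φ₀ : B n).1 x‖ ≤ 2 * C := by
    intro x
    refine (norm_sub_le _ _).trans ?_
    have h1 := (B.norm_le_deriv_zero (φ : B n) x).trans (hC φ φ.2)
    have h2 := (B.norm_le_deriv_zero (φ₀ : B n) x).trans (hC φ₀ φ₀.2)
    linarith
  rw [dist_eq_norm, ← map_sub, integralForm_apply]
  have hint := (B.integrable_mul ((φ : B n) - (φ₀ : B n)) hq).norm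
  refine (norm_integral_le_integral_norm _).trans_lt ?_
  rw [← integral_add_compl hKm hint]
  have hI1 : ∫ x in K, ‖((φ : B n) - (φ₀ : B n) : B n).1 x * q x‖ ≤ δ * Q := by
    refine (setIntegral_mono_on hint.integrableOn (hq.norm.const_mul δ).integrableOn hKm
      fun x hx => ?_).trans ((setIntegral_le_integral (hq.norm.const_mul δ)
        (Eventually.of_forall fun x => by positivity)).trans_eq (integral_const_mul _ _))
    rw [norm_mul]
    exact mul_le_mul_of_nonneg_right (hin x hx) (norm_nonneg _)
  have hI2 : ∫ x in Kᶜ, ‖((φ : B n) - (φ₀ : B n) : B n).1 x * q x‖ ≤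
      2 * C * ∫ x in Kᶜ, ‖q x‖ := by
    rw [← integral_const_mul]
    refine setIntegral_mono_on hint.integrableOn (hq.norm.const_mul _).integrableOn hKm.compl
      fun x _ => ?_
    rw [norm_mul]
    exact mul_le_mul_of_nonneg_right (hall x) (norm_nonneg _)
  have h3 : δ * Q < ε / 2 := by
    rw [hδ, div_mul_eq_mul_div, div_lt_div_iff₀ (by positivity) (by norm_num)]
    nlinarith
  have h4 : 2 * C * ∫ x in Kᶜ, ‖q x‖ ≤ ε / 2 := by
    refine (mul_le_mul_of_nonneg_left hout.le (by positivity)).trans ?_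
    rw [mul_div_assoc', div_le_div_iff₀ (by positivity) (by norm_num)]
    nlinarith
  linarith

/-- The `k`-th derivative, as a linear map from `𝓑_c` to the space of continuous functions. -/
def Bc.derivC (k : ℕ) : Bc n →ₗ[ℂ] C(Rn n, Rn n [×k]→L[ℝ] ℂ) where
  toFun φ := (B.deriv k (φ : B n)).toContinuousMap
  map_add' f g := by
    have h := (B.deriv k).map_add (f : B n) (g : B n)
    exact congrArg BoundedContinuousFunction.toContinuousMap h
  map_smul' c f := by
    have h := (B.deriv k).map_smul c (f : B n)
    exact congrArg BoundedContinuousFunction.toContinuousMap h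

/-- Refining the C^∞ topology just enough to make U continuous keeps it locally convex and changes
nothing on bounded sets, where U is already continuous. As 𝓑_c carries a still finer topology, U is
continuous on it. -/
theorem isAdmissible_smoothTopology_inf (U : Bc n →ₗ[ℂ] ℂ)
    (hU : ∀ S : Set (B n), B.IsBddSet S →
      Continuous[TopologicalSpace.induced (fun φ : S => (φ : B n)) (B.smoothTopology n), _]
        (fun φ : S => U (B.toBc (φ : B n)))) :
    (⨅ k, TopologicalSpace.induced (Bc.derivC (n := n) k) ContinuousMap.compactOpen) ⊓
      TopologicalSpace.induced U PseudoMetricSpace.toUniformSpace.toTopologicalSpace ∈ Bc.admissible n := by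
  have hsmul : ∀ (r : ℝ) (φ : Bc n), r • φ = (r : ℂ) • φ := fun r φ =>
    Subtype.ext (funext fun x => Complex.real_smul)
  refine ⟨?_, ?_, ?_, fun S hS => ?_⟩
  · exact topologicalAddGroup_inf (topologicalAddGroup_iInf fun k => topologicalAddGroup_induced _)
      (topologicalAddGroup_induced U)
  · exact @continuousSMul_inf _ _ _ _ _ _ (continuousSMul_iInf fun k => continuousSMul_induced _)
      (continuousSMul_induced U)
  · let D : ∀ k, Bc n →ₗ[ℝ] C(Rn n, Rn n [×k]→L[ℝ] ℂ) := fun k =>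
      { toFun := Bc.derivC k
        map_add' := map_add _
        map_smul' := fun r φ => by
          rw [hsmul, map_smul]
          ext x v
          exact (Complex.real_smul (x := r)).symm }
    let U' : Bc n →ₗ[ℝ] ℂ :=
      { toFun := U
        map_add' := map_add _
        map_smul' := fun r φ => by
          rw [hsmul, map_smul]
          exact (Complex.real_smul (x := r)).symm }
    exact LocallyConvexSpace.inf (LocallyConvexSpace.iInf fun k => LocallyConvexSpace.induced (D k))
      (LocallyConvexSpace.induced U')
  · rw [induced_inf]
    have h1 : TopologicalSpace.induced (fun φ : S => B.toBc (φ : B n))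
        (⨅ k, TopologicalSpace.induced (Bc.derivC (n := n) k) ContinuousMap.compactOpen) =
        TopologicalSpace.induced (fun φ : S => (φ : B n)) (B.smoothTopology n) := rfl
    rw [h1, inf_eq_left, induced_compose, ← continuous_iff_le_induced]
    exact hU S hS

/-- Integration against an integrable function, as a continuous linear form on `𝓑_c`. -/
def integralBc {q : Rn n → ℂ} (hq : Integrable q) : Bc n →L[ℂ] ℂ :=
  ⟨(integralForm hq : Bc n →ₗ[ℂ] ℂ), by
    refine continuous_sInf_dom (isAdmissible_smoothTopology_inf (integralForm hq : Bc n →ₗ[ℂ] ℂ)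
      fun S hS => integralForm_continuous_on_bdd hq hS) ?_
    exact continuous_iff_le_induced.2 inf_le_right⟩

theorem memDL1'_of_integrable {q : Rn n → ℂ} (hq : Integrable q) {u : 𝓢'(Rn n, ℂ)}
    (hu : ∀ φ : 𝓢(Rn n, ℂ), u φ = ∫ x, φ x * q x) : MemDL1' u :=
  ⟨integralDot hq, fun φ => (hu φ).symm⟩

theorem hasIntegral_of_integrable {q : Rn n → ℂ} (hq : Integrable q) {u : 𝓢'(Rn n, ℂ)}
    (hu : ∀ φ : 𝓢(Rn n, ℂ), u φ = ∫ x, φ x * q x) : HasIntegral u (∫ x, q x) := by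
  refine ⟨integralDot hq, fun φ => (hu φ).symm, integralBc hq, fun φ => rfl, ?_⟩
  calc integralBc hq (Bc.one n) = ∫ x, (1 : ℂ) * q x := rfl
    _ = ∫ x, q x := by simp only [one_mul]

end

section

/-! ### Weighted translates -/

variable {n : ℕ}

theorem derivBound_const {E : Type*} [NormedAddCommGroup E] [NormedSpace ℝ E] (c : ℂ) :
    DerivBound (fun _ : E => 1) (fun _ : E => c) := by
  refine ⟨contDiff_const, fun k => ⟨‖c‖, norm_nonneg c, fun p => ?_⟩⟩
  rcases k with _ | k
  · simp
  · rw [iteratedFDeriv_const_of_ne (Nat.succ_ne_zero k)]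
    simp

theorem DerivBound.hasTemperateGrowth {Φ : Rn n → ℂ} (h : DerivBound (fun _ => 1) Φ) :
    Φ.HasTemperateGrowth := by
  refine ⟨h.1, fun k => ?_⟩
  obtain ⟨C, -, hb⟩ := h.2 k
  exact ⟨0, C, fun x => by simpa using hb x⟩

theorem derivBound_of_hasCompactSupport {Φ : Rn n → ℂ} (hΦ : ContDiff ℝ ∞ Φ)
    (hs : HasCompactSupport Φ) (s : ℝ) : DerivBound (fun x => wt x ^ s) Φ := by
  refine ⟨hΦ, fun k => ?_⟩
  have hc : Continuous fun x : Rn n => wt x ^ (-s) :=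
    continuous_wt.rpow_const fun x => Or.inl (wt_pos x).ne'
  have hs' : HasCompactSupport ((fun x : Rn n => wt x ^ (-s)) • iteratedFDeriv ℝ k Φ) :=
    (hs.iteratedFDeriv (𝕜 := ℝ) k).smul_left
  obtain ⟨C, hC⟩ := hs'.exists_bound_of_continuous
    (hc.smul (hΦ.continuous_iteratedFDeriv (by exact_mod_cast le_top)))
  refine ⟨C, (norm_nonneg _).trans (hC 0), fun x => ?_⟩
  have h1 := hC x
  have hp : 0 < wt x ^ s := Real.rpow_pos_of_pos (wt_pos x) s
  rw [Pi.smul_apply', norm_smul, Real.rpow_neg (wt_pos x).le, norm_inv,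
    Real.norm_of_nonneg hp.le, inv_mul_le_iff₀ hp] at h1
  linarith

/-- A weight on `ℝⁿ × ℝⁿ` whose integral in the first variable is independent of the second. -/
def pairWt (μ : ℝ) (p : Rn n × Rn n) : ℝ := wt (p.1 - p.2) ^ (-μ) + wt p.1 ^ (-μ)

theorem pairWt_le_two {μ : ℝ} (hμ : 0 ≤ μ) (p : Rn n × Rn n) : pairWt μ p ≤ 2 * 1 := by
  have h : ∀ x : Rn n, wt x ^ (-μ) ≤ 1 := fun x =>
    Real.rpow_le_one_of_one_le_of_nonpos (one_le_wt x) (by linarith)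
  have h1 := h (p.1 - p.2)
  have h2 := h p.1
  rw [pairWt]
  linarith

theorem DerivBound.bounded_of_pairWt {μ : ℝ} (hμ : 0 ≤ μ) {Φ : Rn n × Rn n → ℂ}
    (h : DerivBound (pairWt μ) Φ) : DerivBound (fun _ => 1) Φ :=
  h.mono zero_le_two (pairWt_le_two hμ)

theorem integrable_pairWt {μ : ℝ} (hμ : (n : ℝ) < μ) (x : Rn n) :
    Integrable (fun ξ => pairWt μ (ξ, x)) ∧
      ∫ ξ, pairWt μ (ξ, x) = 2 * ∫ ξ : Rn n, wt ξ ^ (-μ) := by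
  have h1 := wt_rpow_integrable hμ
  have h2 := h1.comp_sub_right x
  refine ⟨h2.add h1, ?_⟩
  have h3 := integral_add h2 h1
  have h4 := integral_sub_right_eq_self (μ := volume) (fun ξ : Rn n => wt ξ ^ (-μ)) x
  rw [h4] at h3
  calc _ = ∫ ξ : Rn n, (wt (ξ - x) ^ (-μ) + wt ξ ^ (-μ)) := rfl
    _ = _ := by rw [h3]; ring

/-- M is uniform in x because the integral of `pairWt` does not depend on x. This is the pointwise
hypothesis of `Jet.integrable_dual`. -/
theorem integrable_jet_slice {μ : ℝ} (hμ : (n : ℝ) < μ) {Φ : Rn n × Rn n → ℂ}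
    (h : DerivBound (pairWt μ) Φ) (h1 : DerivBound (fun _ => 1) Φ) (m : ℕ) :
    ∃ M, 0 ≤ M ∧ ∀ (k : Fin (m + 1)) (x : Rn n),
      Integrable (fun ξ => B.jet m (slice h1 ξ) k x) ∧ ∫ ξ, ‖B.jet m (slice h1 ξ) k x‖ ≤ M := by
  choose C hC hb using h.slice_bound
  set I : ℝ := ∫ ξ : Rn n, wt ξ ^ (-μ) with hI
  have hI0 : 0 ≤ I := integral_nonneg fun ξ => Real.rpow_nonneg (wt_pos ξ).le _
  have h0 : 0 ≤ ∑ k ∈ Finset.range (m + 1), C k := Finset.sum_nonneg fun k _ => hC k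
  refine ⟨(∑ k ∈ Finset.range (m + 1), C k) * (2 * I), by positivity, fun k x => ?_⟩
  have hcont : Continuous fun ξ => B.jet m (slice h1 ξ) k x :=
    (Jet.eval k x).continuous.comp (continuous_jet_slice h1 m)
  obtain ⟨hp, hpI⟩ := integrable_pairWt hμ x
  have hint : Integrable (fun ξ => B.jet m (slice h1 ξ) k x) :=
    (hp.const_mul (C k)).mono' hcont.aestronglyMeasurable
      (Eventually.of_forall fun ξ => hb k ξ x)
  refine ⟨hint, (integral_mono hint.norm (hp.const_mul (C k)) fun ξ => hb k ξ x).trans ?_⟩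
  rw [integral_const_mul, hpI]
  exact mul_le_mul_of_nonneg_right
    (Finset.single_le_sum (f := C) (fun k _ => hC k) (Finset.mem_range.2 k.2)) (by positivity)

theorem norm_jet_slice_le {ρ : Rn n → ℝ} (hρ : ∀ ξ, 0 ≤ ρ ξ) {Φ : Rn n × Rn n → ℂ}
    (h : DerivBound (fun p => ρ p.1) Φ) (h1 : DerivBound (fun _ => 1) Φ) (m : ℕ) :
    ∃ C, 0 ≤ C ∧ ∀ ξ, ‖B.jet m (slice h1 ξ)‖ ≤ C * ρ ξ := by
  choose C hC hb using h.slice_bound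
  have h0 : 0 ≤ ∑ k ∈ Finset.range (m + 1), C k := Finset.sum_nonneg fun k _ => hC k
  refine ⟨_, h0, fun ξ => B.norm_jet_le (mul_nonneg h0 (hρ ξ)) fun k hk x => (hb k ξ x).trans ?_⟩
  exact mul_le_mul_of_nonneg_right
    (Finset.single_le_sum (f := C) (fun k _ => hC k) (Finset.mem_range.2 (by omega))) (hρ ξ)

/-- The functions `ξ ↦ L(Φ(ξ, ·))` are smooth with bounded and integrable derivatives. -/
theorem jetForm_slice_regular {μ : ℝ} (hμ : (n : ℝ) < μ) {m : ℕ} (L : Jet n m →L[ℂ] ℂ)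
    {Φ : Rn n × Rn n → ℂ} (h : DerivBound (pairWt μ) Φ) (h1 : DerivBound (fun _ => 1) Φ) :
    DerivBound (fun _ => 1) (fun ξ => L (B.jet m (slice h1 ξ))) ∧
      MemDL1 (fun ξ => L (B.jet m (slice h1 ξ))) := by
  -- A partial derivative in ξ replaces Φ by a partial derivative of Φ, which obeys the same weight
  -- bound.
  set 𝒞 : Set (Rn n → ℂ) := {G | ∃ (Φ : Rn n × Rn n → ℂ) (_ : DerivBound (pairWt μ) Φ)
    (h1 : DerivBound (fun _ => 1) Φ), G = fun ξ => L (B.jet m (slice h1 ξ))} with h𝒞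
  have hpart : ∀ G ∈ 𝒞, ∃ H, (∀ i, H i ∈ 𝒞) ∧ HasPartials G H := by
    rintro _ ⟨Φ, h, h1, rfl⟩
    exact ⟨_, fun i => ⟨_, h.fderiv_apply _, _, rfl⟩, hasPartials_slice h1 L⟩
  have hmem : (fun ξ => L (B.jet m (slice h1 ξ))) ∈ 𝒞 := ⟨Φ, h, h1, rfl⟩
  refine ⟨derivBound_of_hasPartials hpart ?_ hmem, contDiff_of_hasPartials hpart hmem,
    fun k => ?_⟩
  · rintro _ ⟨Φ, h, h1, rfl⟩
    obtain ⟨C, hC, hb⟩ := norm_jet_slice_le (ρ := fun _ => 1) (fun _ => zero_le_one) h1 h1 m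
    refine ⟨‖L‖ * C, by positivity, fun ξ => (L.le_opNorm _).trans ?_⟩
    rw [mul_assoc]
    exact mul_le_mul_of_nonneg_left (hb ξ) (norm_nonneg L)
  · obtain ⟨s, C, hs, -, hb⟩ := norm_iteratedFDeriv_le_of_hasPartials hpart k hmem
    have hint : ∀ G ∈ 𝒞, Integrable G := by
      rintro _ ⟨Φ, h, h1, rfl⟩
      obtain ⟨M, -, hM⟩ := integrable_jet_slice hμ h h1 m
      exact (Jet.integrable_dual L (continuous_jet_slice h1 m) hM).1
    have hsum : Integrable fun ξ => C * ∑ H ∈ s, ‖H ξ‖ :=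
      (integrable_finsetSum s fun H hH => (hint H (hs hH)).norm).const_mul C
    exact hsum.mono' ((contDiff_of_hasPartials hpart hmem).continuous_iteratedFDeriv
      (by exact_mod_cast le_top)).aestronglyMeasurable (Eventually.of_forall hb)

/-- The function `(ξ, x) ↦ w(ξ)^{-μ} w(x)^μ κ(ξ - x)`. -/
def weightedTranslate (μ : ℝ) (κ : Rn n → ℂ) (p : Rn n × Rn n) : ℂ :=
  wPow (-μ) p.1 * wPow μ p.2 * κ (p.1 - p.2)

theorem derivBound_weightedTranslate_aux (μ : ℝ) {κ : Rn n → ℂ}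
    (hκ : DerivBound (fun x => wt x ^ (-μ)) κ) :
    DerivBound (fun p : Rn n × Rn n => wt p.1 ^ (-μ) * wt p.2 ^ μ * wt (p.1 - p.2) ^ (-μ))
      (weightedTranslate μ κ) :=
  (((derivBound_wPow (-μ)).comp_clm (ContinuousLinearMap.fst ℝ (Rn n) (Rn n))).mul
    ((derivBound_wPow μ).comp_clm (ContinuousLinearMap.snd ℝ (Rn n) (Rn n)))).mul
    (hκ.comp_clm (ContinuousLinearMap.fst ℝ (Rn n) (Rn n) -
      ContinuousLinearMap.snd ℝ (Rn n) (Rn n)))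

/-- Peetre's inequality for w(x)^μ, divided by w(ξ)^μ w(ξ - x)^μ. -/
theorem derivBound_weightedTranslate {μ : ℝ} (hμ : 0 ≤ μ) {κ : Rn n → ℂ}
    (hκ : DerivBound (fun x => wt x ^ (-μ)) κ) :
    DerivBound (pairWt μ) (weightedTranslate μ κ) := by
  refine (derivBound_weightedTranslate_aux μ hκ).mono (c := 2 ^ μ) (by positivity) fun p => ?_
  have h1 := wt_rpow_le hμ p.1 p.2
  have a0 : 0 < wt p.1 ^ μ := Real.rpow_pos_of_pos (wt_pos _) _
  have b0 : 0 < wt (p.1 - p.2) ^ μ := Real.rpow_pos_of_pos (wt_pos _) _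
  rw [pairWt, Real.rpow_neg (wt_pos _).le, Real.rpow_neg (wt_pos _).le]
  calc (wt p.1 ^ μ)⁻¹ * wt p.2 ^ μ * (wt (p.1 - p.2) ^ μ)⁻¹
      ≤ (wt p.1 ^ μ)⁻¹ * (2 ^ μ * (wt p.1 ^ μ + wt (p.1 - p.2) ^ μ)) *
        (wt (p.1 - p.2) ^ μ)⁻¹ := by gcongr
    _ = 2 ^ μ * ((wt (p.1 - p.2) ^ μ)⁻¹ + (wt p.1 ^ μ)⁻¹) := by
        field_simp

/-- The compactly supported cutoff absorbs w(x)^μ. The remaining bound depends on ξ alone and is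
integrable when μ > n, at the price of constants depending on j. -/
theorem derivBound_cutoff_weightedTranslate {μ : ℝ} (hμ : 0 ≤ μ) {κ : Rn n → ℂ}
    (hκ : DerivBound (fun x => wt x ^ (-μ)) κ) (j : ℕ) :
    DerivBound (fun p : Rn n × Rn n => wt p.1 ^ (-μ))
      (fun p => (cutoff n j : Rn n → ℂ) p.2 * weightedTranslate μ κ p) := by
  have h := ((derivBound_of_hasCompactSupport (cutoff n j).2.1 (hasCompactSupport_cutoff j)
    (-μ)).comp_clm (ContinuousLinearMap.snd ℝ (Rn n) (Rn n))).mul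
    (derivBound_weightedTranslate_aux μ hκ)
  refine h.mono zero_le_one fun p => ?_
  have b0 : 0 < wt p.2 ^ μ := Real.rpow_pos_of_pos (wt_pos _) _
  have c1 : wt (p.1 - p.2) ^ (-μ) ≤ 1 :=
    Real.rpow_le_one_of_one_le_of_nonpos (one_le_wt _) (by linarith)
  have a0 : 0 ≤ wt p.1 ^ (-μ) := Real.rpow_nonneg (wt_pos _).le _
  have e : wt p.2 ^ (-μ) * wt p.2 ^ μ = 1 := by
    rw [← Real.rpow_add (wt_pos _), neg_add_cancel, Real.rpow_zero]
  calc wt p.2 ^ (-μ) * (wt p.1 ^ (-μ) * wt p.2 ^ μ * wt (p.1 - p.2) ^ (-μ))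
      = (wt p.2 ^ (-μ) * wt p.2 ^ μ) * wt p.1 ^ (-μ) * wt (p.1 - p.2) ^ (-μ) := by ring
    _ ≤ 1 * wt p.1 ^ (-μ) := by
      rw [e, one_mul]
      exact mul_le_of_le_one_right a0 c1

/-- The slices of a weighted translate. -/
def translateSlice {μ : ℝ} (hμ : 0 ≤ μ) {κ : Rn n → ℂ} (hκ : DerivBound (fun x => wt x ^ (-μ)) κ)
    (ξ : Rn n) : B n :=
  slice ((derivBound_weightedTranslate hμ hκ).bounded_of_pairWt hμ) ξ

/-! ### Interchange of a linear form with integration over slices -/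

section Interchange

variable {μ : ℝ} {κ : Rn n → ℂ} {m : ℕ}

/-- The constant M is chosen before the form V, so the estimate applies to the small remainders U -
U(χ_j ·), with χ_j the cutoffs, uniformly in j. -/
theorem integrable_linearForm_translateSlice (hμ : (n : ℝ) < μ) (hμ0 : 0 ≤ μ)
    (hκ : DerivBound (fun x => wt x ^ (-μ)) κ) (m : ℕ) :
    ∃ M, 0 ≤ M ∧ ∀ (V : B n →ₗ[ℂ] ℂ) (ε : ℝ), 0 ≤ ε → (∀ ψ, ‖V ψ‖ ≤ ε * ‖B.jet m ψ‖) →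
      Integrable (fun ξ => V (translateSlice hμ0 hκ ξ)) ∧
        ∫ ξ, ‖V (translateSlice hμ0 hκ ξ)‖ ≤ ε * M := by
  have h := derivBound_weightedTranslate hμ0 hκ
  have h1 := h.bounded_of_pairWt hμ0
  obtain ⟨M, hM0, hM⟩ := integrable_jet_slice hμ h h1 m
  refine ⟨M, hM0, fun V ε hε hV => ?_⟩
  obtain ⟨L, hL, hLV⟩ := B.exists_jet_extension V hε hV
  have h2 := Jet.integrable_dual L (continuous_jet_slice h1 m) hM
  have h3 : (fun ξ => V (translateSlice hμ0 hκ ξ)) = fun ξ => L (B.jet m (slice h1 ξ)) :=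
    funext fun ξ => (hLV _).symm
  have h4 : (fun ξ => ‖V (translateSlice hμ0 hκ ξ)‖) = fun ξ => ‖L (B.jet m (slice h1 ξ))‖ :=
    funext fun ξ => by rw [← hLV]; rfl
  rw [h3, h4]
  exact ⟨h2.1, h2.2.trans (mul_le_mul_of_nonneg_right hL hM0)⟩

theorem tendsto_integral_cutoff (hμ : (n : ℝ) < μ) (hμ0 : 0 ≤ μ)
    (hκ : DerivBound (fun x => wt x ^ (-μ)) κ) {A : ℝ} (hA : 0 ≤ A) {U : B n →ₗ[ℂ] ℂ}
    (hU : ∀ ψ, ‖U ψ‖ ≤ A * ‖B.jet m ψ‖)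
    (hcut : ∀ ε > 0, ∃ J, ∀ j ≥ J, ∀ ψ, ‖U ψ - U (B.mul (cutoff n j) ψ)‖ ≤ ε * ‖B.jet m ψ‖)
    {a : Rn n → ℂ} (ha : Continuous a) {D : ℝ} (haD : ∀ ξ, ‖a ξ‖ ≤ D) :
    Tendsto (fun j => ∫ ξ, a ξ * U (B.mul (cutoff n j) (translateSlice hμ0 hκ ξ))) atTop
      (𝓝 (∫ ξ, a ξ * U (translateSlice hμ0 hκ ξ))) := by
  obtain ⟨M, hM0, hM⟩ := integrable_linearForm_translateSlice hμ hμ0 hκ m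
  have hD : 0 ≤ D := (norm_nonneg _).trans (haD 0)
  have hint : ∀ V : B n →ₗ[ℂ] ℂ, Integrable (fun ξ => V (translateSlice hμ0 hκ ξ)) →
      Integrable fun ξ => a ξ * V (translateSlice hμ0 hκ ξ) := fun V hV =>
    hV.bdd_mul ha.aestronglyMeasurable (Eventually.of_forall haD)
  have hiU := hint U (hM U A hA hU).1
  refine Metric.tendsto_atTop.2 fun ε hε => ?_
  obtain ⟨J, hJ⟩ := hcut (ε / (D * M + 1)) (by positivity)
  refine ⟨J, fun j hj => ?_⟩
  set V : B n →ₗ[ℂ] ℂ := U - U ∘ₗ B.mul (cutoff n j) with hV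
  obtain ⟨hV1, hV2⟩ := hM V (ε / (D * M + 1)) (by positivity) (hJ j hj)
  have h1 : ∀ ξ, a ξ * U (B.mul (cutoff n j) (translateSlice hμ0 hκ ξ)) =
      a ξ * U (translateSlice hμ0 hκ ξ) - a ξ * V (translateSlice hμ0 hκ ξ) := fun ξ => by
    simp only [hV, LinearMap.sub_apply, LinearMap.comp_apply]
    ring
  simp only [h1]
  rw [integral_sub hiU (hint V hV1), dist_eq_norm, sub_sub_cancel_left, norm_neg]
  refine (norm_integral_le_integral_norm _).trans_lt ?_
  calc ∫ ξ, ‖a ξ * V (translateSlice hμ0 hκ ξ)‖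
      ≤ ∫ ξ, D * ‖V (translateSlice hμ0 hκ ξ)‖ := by
        refine integral_mono (hint V hV1).norm (hV1.norm.const_mul D) fun ξ => ?_
        simp only [norm_mul]
        exact mul_le_mul_of_nonneg_right (haD ξ) (norm_nonneg _)
    _ ≤ D * (ε / (D * M + 1) * M) := by
        rw [integral_const_mul]
        exact mul_le_mul_of_nonneg_left hV2 hD
    _ < ε := by
        rw [div_mul_eq_mul_div, mul_div_assoc', div_lt_iff₀ (by positivity)]
        nlinarith

theorem integrable_jet_cutoff (hμ : (n : ℝ) < μ) (hμ0 : 0 ≤ μ)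
    (hκ : DerivBound (fun x => wt x ^ (-μ)) κ) (m j : ℕ)
    {a : Rn n → ℂ} (ha : Continuous a) {D : ℝ} (haD : ∀ ξ, ‖a ξ‖ ≤ D) :
    Integrable fun ξ => B.jet m (a ξ • B.mul (cutoff n j) (translateSlice hμ0 hκ ξ)) := by
  have h := derivBound_cutoff_weightedTranslate hμ0 hκ j
  have h1 : DerivBound (fun _ => 1) _ := h.mono (σ := fun _ => 1) zero_le_one fun p => by
    rw [one_mul]
    exact Real.rpow_le_one_of_one_le_of_nonpos (one_le_wt _) (by linarith)
  have hD : 0 ≤ D := (norm_nonneg _).trans (haD 0)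
  obtain ⟨C, hC, hb⟩ := norm_jet_slice_le (ρ := fun ξ => wt ξ ^ (-μ))
    (fun ξ => Real.rpow_nonneg (wt_pos ξ).le _) h h1 m
  have he : (fun ξ => B.jet m (a ξ • B.mul (cutoff n j) (translateSlice hμ0 hκ ξ))) =
      fun ξ => a ξ • B.jet m (slice h1 ξ) := by
    funext ξ
    rw [map_smul]
    rfl
  rw [he]
  refine ((wt_rpow_integrable hμ).const_mul (D * C)).mono'
    (ha.smul (continuous_jet_slice h1 m)).aestronglyMeasurable (Eventually.of_forall fun ξ => ?_)
  rw [norm_smul, mul_assoc]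
  exact mul_le_mul (haD ξ) (hb ξ) (norm_nonneg _) hD

/-- With a cutoff, both sides are one continuous form applied to Bochner integrals of jets, which
agree because their values at order zero do. Letting the cutoff tend to 1 gives the claim. -/
theorem integral_linearForm_eq (hμ : (n : ℝ) < μ) (hμ0 : 0 ≤ μ) {κ₁ κ₂ : Rn n → ℂ}
    (hκ₁ : DerivBound (fun x => wt x ^ (-μ)) κ₁) (hκ₂ : DerivBound (fun x => wt x ^ (-μ)) κ₂)
    {A : ℝ} (hA : 0 ≤ A) {U : B n →ₗ[ℂ] ℂ} (hU : ∀ ψ, ‖U ψ‖ ≤ A * ‖B.jet m ψ‖)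
    (hcut : ∀ ε > 0, ∃ J, ∀ j ≥ J, ∀ ψ, ‖U ψ - U (B.mul (cutoff n j) ψ)‖ ≤ ε * ‖B.jet m ψ‖)
    {a₁ a₂ : Rn n → ℂ} (ha₁ : Continuous a₁) (ha₂ : Continuous a₂) {D₁ D₂ : ℝ}
    (hD₁ : ∀ ξ, ‖a₁ ξ‖ ≤ D₁) (hD₂ : ∀ ξ, ‖a₂ ξ‖ ≤ D₂)
    (heq : ∀ x, ∫ ξ, a₁ ξ * weightedTranslate μ κ₁ (ξ, x) =
      ∫ ξ, a₂ ξ * weightedTranslate μ κ₂ (ξ, x)) :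
    ∫ ξ, a₁ ξ * U (translateSlice hμ0 hκ₁ ξ) = ∫ ξ, a₂ ξ * U (translateSlice hμ0 hκ₂ ξ) := by
  refine tendsto_nhds_unique (tendsto_integral_cutoff hμ hμ0 hκ₁ hA hU hcut ha₁ hD₁) ?_
  refine (tendsto_integral_cutoff hμ hμ0 hκ₂ hA hU hcut ha₂ hD₂).congr fun j => ?_
  obtain ⟨L, -, hL⟩ := B.exists_jet_extension U hA hU
  have key : ∀ {κ : Rn n → ℂ} (hκ : DerivBound (fun x => wt x ^ (-μ)) κ) {a : Rn n → ℂ}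
      (_ : Continuous a) {D : ℝ} (_ : ∀ ξ, ‖a ξ‖ ≤ D),
      ∫ ξ, a ξ * U (B.mul (cutoff n j) (translateSlice hμ0 hκ ξ)) =
        L (∫ ξ, B.jet m (a ξ • B.mul (cutoff n j) (translateSlice hμ0 hκ ξ))) := by
    intro κ hκ a ha D hD
    rw [← L.integral_comp_comm (integrable_jet_cutoff hμ hμ0 hκ m j ha hD)]
    refine integral_congr_ae (Eventually.of_forall fun ξ => ?_)
    simp only [hL, map_smul, smul_eq_mul]
  have hval : ∀ {κ : Rn n → ℂ} (hκ : DerivBound (fun x => wt x ^ (-μ)) κ) (a : Rn n → ℂ) (x : Rn n),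
      ∫ ξ, (a ξ • B.mul (cutoff n j) (translateSlice hμ0 hκ ξ) : B n).1 x =
        (cutoff n j : Rn n → ℂ) x * ∫ ξ, a ξ * weightedTranslate μ κ (ξ, x) := by
    intro κ hκ a x
    rw [← integral_const_mul]
    exact integral_congr_ae (Eventually.of_forall fun ξ => mul_left_comm _ _ _)
  rw [key hκ₁ ha₁ hD₁, key hκ₂ ha₂ hD₂]
  congr 1
  refine (Jet.integral_eq_integral (integrable_jet_cutoff hμ hμ0 hκ₁ m j ha₁ hD₁)
    (integrable_jet_cutoff hμ hμ0 hκ₂ m j ha₂ hD₂) fun x => ?_).symm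
  rw [hval hκ₁, hval hκ₂, heq]

end Interchange

end

section

/-! ### The kernel, the Schwartz functions and the convolution -/

variable {n : ℕ}

/-- Write φ as w^{-μ} times the Schwartz function w^μ φ, whose derivatives are bounded. -/
theorem derivBound_schwartz (μ : ℝ) (φ : 𝓢(Rn n, ℂ)) : DerivBound (fun x => wt x ^ (-μ)) φ := by
  set ψ : 𝓢(Rn n, ℂ) := SchwartzMap.smulLeftCLM ℂ (wPow μ) φ with hψ
  have h := (derivBound_wPow (n := n) (-μ)).mul (B.derivBound ⟨ψ, schwartz_mem_B ψ⟩)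
  have h1 : (φ : Rn n → ℂ) = fun x => wPow (-μ) x * ψ x := by
    funext x
    rw [hψ, SchwartzMap.smulLeftCLM_apply_apply (wPow_hasTemperateGrowth μ), smul_eq_mul,
      ← mul_assoc, wPow_mul_wPow, neg_add_cancel, wPow_zero, one_mul]
  rw [h1]
  exact h.mono (c := 1) zero_le_one fun x => by simp

theorem derivBound_schwartz_neg (μ : ℝ) (φ : 𝓢(Rn n, ℂ)) :
    DerivBound (fun x => wt x ^ (-μ)) fun x => φ (-x) :=
  ((derivBound_schwartz μ φ).comp_clm (-ContinuousLinearMap.id ℝ (Rn n))).mono (c := 1)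
    zero_le_one fun x => by simp [wt_neg]

theorem wt_le_wt_inv_smul {y : ℝ} (hy : 0 < y) (x : Rn n) :
    wt x ≤ max 1 y * wt (y⁻¹ • x) := by
  have hm : 0 ≤ max 1 y := zero_le_one.trans (le_max_left _ _)
  rw [wt_eq_sqrt, wt_eq_sqrt, ← Real.sqrt_sq hm, ← Real.sqrt_mul (sq_nonneg _)]
  refine Real.sqrt_le_sqrt ?_
  have h1 : 1 ≤ max 1 y ^ 2 := one_le_pow₀ (le_max_left _ _)
  have h2 : y ^ 2 ≤ max 1 y ^ 2 := pow_le_pow_left₀ hy.le (le_max_right _ _) 2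
  have h3 : ‖x‖ ^ 2 = y ^ 2 * ‖y⁻¹ • x‖ ^ 2 := by
    rw [norm_smul, norm_inv, Real.norm_of_nonneg hy.le]
    field_simp
  rw [h3]
  nlinarith [mul_le_mul_of_nonneg_right h2 (sq_nonneg ‖y⁻¹ • x‖)]

theorem kernel_neg (α y : ℝ) (x : Rn n) : kernel α y (-x) = kernel α y x := by
  simp [kernel]

/-- The kernel is a constant multiple of w^{-μ}(x/y), and w(x) and w(x/y) are comparable for fixed
y. -/
theorem derivBound_kernel {α y : ℝ} (hα : 0 ≤ α + n + 1) (hy : 0 < y) :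
    DerivBound (fun x : Rn n => wt x ^ (-(α + n + 1))) fun x => (kernel α y x : ℂ) := by
  set μ : ℝ := α + n + 1 with hμ
  set c : ℝ := Real.Gamma (μ / 2) / (Real.Gamma ((α + 1) / 2) * Real.pi ^ ((n : ℝ) / 2)) *
    y ^ (α + 1) * (y ^ 2) ^ (-(μ / 2)) with hc
  have h := (derivBound_const (E := Rn n) (c : ℂ)).mul
    ((derivBound_wPow (n := n) (-μ)).comp_clm (y⁻¹ • ContinuousLinearMap.id ℝ (Rn n)))
  have heq : (fun x : Rn n => (kernel α y x : ℂ)) =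
      fun x => (c : ℂ) * wPow (-μ) ((y⁻¹ • ContinuousLinearMap.id ℝ (Rn n)) x) := by
    funext x
    have hx : ‖x‖ ^ 2 + y ^ 2 = y ^ 2 * (1 + ‖y⁻¹ • x‖ ^ 2) := by
      rw [norm_smul, norm_inv, Real.norm_of_nonneg hy.le]
      field_simp
      ring
    have hp : wPow (-μ) ((y⁻¹ • ContinuousLinearMap.id ℝ (Rn n)) x) =
        (((1 + ‖y⁻¹ • x‖ ^ 2) ^ (-(μ / 2)) : ℝ) : ℂ) := by
      rw [wPow_eq, wt, ← Real.rpow_mul (by positivity)]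
      congr 2
      ring
    rw [hp, ← Complex.ofReal_mul, kernel, ← hμ, hx, Real.mul_rpow (by positivity) (by positivity),
      div_eq_mul_inv (y ^ (α + 1)), mul_inv, ← Real.rpow_neg (by positivity),
      ← Real.rpow_neg (by positivity), hc]
    congr 1
    ring
  rw [heq]
  refine h.mono (c := max 1 y ^ μ) (by positivity) fun x => ?_
  have h1 : wt x ^ μ ≤ max 1 y ^ μ * wt (y⁻¹ • x) ^ μ := by
    rw [← Real.mul_rpow (by positivity) (wt_pos _).le]
    exact Real.rpow_le_rpow (wt_pos x).le (wt_le_wt_inv_smul hy x) hα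
  have p1 : 0 < wt x ^ μ := Real.rpow_pos_of_pos (wt_pos x) _
  have p2 : 0 < wt (y⁻¹ • x) ^ μ := Real.rpow_pos_of_pos (wt_pos _) _
  have e : (y⁻¹ • ContinuousLinearMap.id ℝ (Rn n)) x = y⁻¹ • x := rfl
  rw [one_mul, e, Real.rpow_neg (wt_pos _).le, Real.rpow_neg (wt_pos _).le, ← div_eq_mul_inv,
    le_div_iff₀ p1, inv_mul_le_iff₀ p2]
  linarith

/-- A function in `w^{-μ} 𝓑` times `w^μ` is continuous and bounded. -/
theorem DerivBound.bounded_mul_wPow {μ : ℝ} {κ : Rn n → ℂ}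
    (hκ : DerivBound (fun x => wt x ^ (-μ)) κ) :
    Continuous (fun x => κ x * wPow μ x) ∧ ∃ D, ∀ x, ‖κ x * wPow μ x‖ ≤ D := by
  refine ⟨hκ.1.continuous.mul (continuous_wPow μ), ?_⟩
  obtain ⟨C, hC, hb⟩ := hκ.norm_le
  refine ⟨C, fun x => ?_⟩
  rw [norm_mul, norm_wPow]
  refine (mul_le_mul_of_nonneg_right (hb x) (Real.rpow_nonneg (wt_pos x).le _)).trans_eq ?_
  rw [mul_assoc, ← Real.rpow_add (wt_pos x), neg_add_cancel, Real.rpow_zero, mul_one]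

theorem MemDL1.integrable {G : Rn n → ℂ} (h : MemDL1 G) : Integrable G := by
  have h0 := (h.2 0).norm
  simp only [norm_iteratedFDeriv_zero] at h0
  exact (integrable_norm_iff h.1.continuous.aestronglyMeasurable).1 h0

theorem apply_eq_of_restricts {μ : ℝ} {f : 𝓢'(Rn n, ℂ)} {T : BDot n →L[ℂ] ℂ}
    (hT : Restricts T (TemperedDistribution.smulLeftCLM ℂ (wPow (-μ)) f)) (φ : 𝓢(Rn n, ℂ)) :
    f φ = T (schwartzToBDot (SchwartzMap.smulLeftCLM ℂ (wPow μ) φ)) := by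
  rw [hT, TemperedDistribution.smulLeftCLM_apply_apply,
    SchwartzMap.smulLeftCLM_smulLeftCLM_apply (wPow_hasTemperateGrowth _)
      (wPow_hasTemperateGrowth _)]
  congr 1
  ext x
  have h1 : (wPow (-μ) * wPow μ : Rn n → ℂ) = fun _ => 1 := funext fun x => by
    rw [Pi.mul_apply, wPow_mul_wPow, neg_add_cancel, wPow_zero]
  rw [h1, SchwartzMap.smulLeftCLM_const]
  simp

/-- The function g is w^μ G, where G(ξ) is `U` on the slice built from the kernel; the reflected
test functions, used as κ in the same slices, describe f̌ * φ. -/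
theorem exists_isSConv_kernel {α : ℝ} (hα : -1 < α) {f : 𝓢'(Rn n, ℂ)}
    (hf : MemWeightedDL1' (α + n + 1) f) {y : ℝ} (hy : 0 < y) :
    ∃ (g : Rn n → ℂ) (hg : MemWeightedDL1 (α + n + 1) g),
      IsSConv (kernelDist n α hy) f (distOf hg.memWeightedL1) := by
  obtain ⟨T, hT⟩ := hf
  set μ : ℝ := α + n + 1 with hμdef
  have hμ : (n : ℝ) < μ := by rw [hμdef]; linarith
  have hμ0 : 0 ≤ μ := n.cast_nonneg.trans hμ.le
  obtain ⟨m, A, U, hA, hUT, hU, hcut⟩ := BDot.exists_extension T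
  have hregular : ∀ {κ : Rn n → ℂ} (hκ : DerivBound (fun x => wt x ^ (-μ)) κ),
      DerivBound (fun _ => 1) (fun ξ => U (translateSlice hμ0 hκ ξ)) ∧
        MemDL1 (fun ξ => U (translateSlice hμ0 hκ ξ)) := by
    intro κ hκ
    obtain ⟨L, -, hL⟩ := B.exists_jet_extension U hA hU
    have h := jetForm_slice_regular hμ L (derivBound_weightedTranslate hμ0 hκ)
      ((derivBound_weightedTranslate hμ0 hκ).bounded_of_pairWt hμ0)
    have he : (fun ξ => U (translateSlice hμ0 hκ ξ)) = fun ξ => L (B.jet m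
        (slice ((derivBound_weightedTranslate hμ0 hκ).bounded_of_pairWt hμ0) ξ)) :=
      funext fun ξ => (hL _).symm
    rwa [he]
  have hK : DerivBound (fun x : Rn n => wt x ^ (-μ)) fun x => (kernel α y x : ℂ) :=
    derivBound_kernel hμ0 hy
  set G : Rn n → ℂ := fun ξ => U (translateSlice hμ0 hK ξ) with hG
  have hcancel : ∀ (s : ℝ) (x : Rn n), wPow (-s) x * wPow s x = 1 := fun s x => by
    rw [wPow_mul_wPow, neg_add_cancel, wPow_zero]
  have hgeq : (fun x => wPow (-μ) x * (wPow μ x * G x)) = G := funext fun x => by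
    rw [← mul_assoc, hcancel, one_mul]
  have hg : MemWeightedDL1 μ (fun x => wPow μ x * G x) := by
    refine ⟨(derivBound_wPow μ).1.mul (hregular hK).2.1, ?_⟩
    rw [hgeq]
    exact (hregular hK).2
  refine ⟨fun x => wPow μ x * G x, hg, ?_⟩
  -- At ξ = -η the slice built from φ(-·) is w(η)^{-μ} w(x)^μ φ(x + η), so the factor w(η)^μ
  -- restores the pairing of f with φ(· + η).
  have hconv : ∀ (φ : 𝓢(Rn n, ℂ)) (η : Rn n), checkConv f φ η =
      wPow μ η * U (translateSlice hμ0 (derivBound_schwartz_neg μ φ) (-η)) := by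
    intro φ η
    rw [checkConv, apply_eq_of_restricts hT, ← hUT, ← smul_eq_mul, ← map_smul]
    congr 1
    refine Subtype.ext (funext fun x => ?_)
    have h1 : (wPow μ η • translateSlice hμ0 (derivBound_schwartz_neg μ φ) (-η) : B n).1 x =
        wPow μ η * (wPow (-μ) (-η) * wPow μ x * φ (-(-η - x))) := rfl
    have h2 : (BDot.toB (schwartzToBDot (SchwartzMap.smulLeftCLM ℂ (wPow μ)
        (SchwartzMap.compSubConstCLM ℂ (-η) φ))) : B n).1 x = wPow μ x * φ (x - -η) := by
      change SchwartzMap.smulLeftCLM ℂ (wPow μ) (SchwartzMap.compSubConstCLM ℂ (-η) φ) x = _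
      rw [SchwartzMap.smulLeftCLM_apply_apply (wPow_hasTemperateGrowth μ)]
      rfl
    rw [h1, h2, wPow_neg_arg, neg_sub]
    linear_combination (-(wPow μ x * φ (x - -η))) * hcancel μ η
  -- Temperate growth is what makes `checkProd` act as pointwise multiplication by f̌ * φ.
  have htemp : ∀ φ : 𝓢(Rn n, ℂ), (checkConv f φ).HasTemperateGrowth := by
    intro φ
    have h1 := ((hregular (derivBound_schwartz_neg μ φ)).1.comp_clm
      (-ContinuousLinearMap.id ℝ (Rn n))).hasTemperateGrowth
    have h2 : checkConv f φ = wPow μ * fun η => U (translateSlice hμ0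
        (derivBound_schwartz_neg μ φ) ((-ContinuousLinearMap.id ℝ (Rn n)) η)) :=
      funext fun η => hconv φ η
    rw [h2]
    exact (wPow_hasTemperateGrowth μ).mul h1
  obtain ⟨hKc, D, hKD⟩ := hK.bounded_mul_wPow
  set a : Rn n → ℂ := fun x => (kernel α y x : ℂ) * wPow μ x with ha
  have ha_neg : ∀ x, a (-x) = a x := fun x => by
    simp only [ha, kernel_neg, wPow_neg_arg]
  have hqeq : ∀ φ : 𝓢(Rn n, ℂ), (fun η => checkConv f φ η * (kernel α y η : ℂ)) =
      fun η => a (-η) * U (translateSlice hμ0 (derivBound_schwartz_neg μ φ) (-η)) := fun φ =>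
    funext fun η => by
      rw [hconv, ha_neg, ha]
      ring
  have hq : ∀ φ : 𝓢(Rn n, ℂ), Integrable fun η => checkConv f φ η * (kernel α y η : ℂ) := by
    intro φ
    rw [hqeq]
    exact ((hregular (derivBound_schwartz_neg μ φ)).2.integrable.bdd_mul
      hKc.aestronglyMeasurable (Eventually.of_forall hKD)).comp_neg
  have hprod : ∀ φ ψ : 𝓢(Rn n, ℂ), checkProd (kernelDist n α hy) f φ ψ =
      ∫ η, ψ η * (checkConv f φ η * (kernel α y η : ℂ)) := by
    intro φ ψ
    rw [checkProd, TemperedDistribution.smulLeftCLM_apply_apply]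
    refine (Function.HasTemperateGrowth.toTemperedDistribution_apply volume
      (kernel_hasTemperateGrowth α hy) _).trans ?_
    refine integral_congr_ae (Eventually.of_forall fun η => ?_)
    simp only [SchwartzMap.smulLeftCLM_apply_apply (htemp φ), smul_eq_mul]
    ring
  refine ⟨fun φ => memDL1'_of_integrable (hq φ) (hprod φ), fun φ => ?_⟩
  have hint : distOf hg.memWeightedL1 φ = ∫ η, checkConv f φ η * (kernel α y η : ℂ) := by
    obtain ⟨hφc, D', hφD⟩ := (derivBound_schwartz μ φ).bounded_mul_wPow
    rw [distOf_apply, hqeq, integral_neg_eq_self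
      (fun η => a η * U (translateSlice hμ0 (derivBound_schwartz_neg μ φ) η))]
    -- The roles are exchanged: φ w^μ is integrated against kernel slices on one side, and the
    -- kernel times w^μ against slices of φ(-·) on the other.
    rw [← integral_linearForm_eq hμ hμ0 hK (derivBound_schwartz_neg μ φ) hA hU hcut hφc hKc
      hφD hKD]
    · exact integral_congr_ae (Eventually.of_forall fun x => (mul_assoc _ _ _).symm)
    · intro x
      -- The substitution ξ ↦ x - ξ and the evenness of the kernel reduce both integrands to w(x)^μ
      -- φ(x - ξ) K(ξ).
      rw [← integral_sub_left_eq_self _ volume x]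
      refine integral_congr_ae (Eventually.of_forall fun ξ => ?_)
      have h1 : x - ξ - x = -ξ := by abel
      simp only [weightedTranslate, h1, kernel_neg, neg_sub]
      linear_combination (wPow μ x * φ (x - ξ) * (kernel α y ξ : ℂ)) *
        (hcancel μ (x - ξ) - hcancel μ ξ)
  rw [hint]
  exact hasIntegral_of_integrable (hq φ) (hprod φ)

/-- Multiplying by w^{-μ} leaves the L¹ function w^{-μ} f, which acts on 𝓑̇ by integration; so the
L¹ statement is a case of the distributional one. -/
theorem memWeightedDL1'_distOf {μ : ℝ} {f : Rn n → ℂ} (hf : MemWeightedL1 μ f) :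
    MemWeightedDL1' μ (distOf hf) := by
  refine memDL1'_of_integrable hf fun φ => ?_
  rw [TemperedDistribution.smulLeftCLM_apply_apply, distOf_apply]
  refine integral_congr_ae (Eventually.of_forall fun x => ?_)
  simp only [SchwartzMap.smulLeftCLM_apply_apply (wPow_hasTemperateGrowth (-μ)), smul_eq_mul]
  ring

end

end GASP

end

theorem lemma4p2 (n : ℕ) (α : ℝ) (hα : -1 < α) :
    (∀ f : 𝓢'(GASP.Rn n, ℂ), GASP.MemWeightedDL1' (α + n + 1) f →
      ∀ (y : ℝ) (hy : 0 < y),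
        ∃ (g : GASP.Rn n → ℂ) (hg : GASP.MemWeightedDL1 (α + n + 1) g),
          GASP.IsSConv (GASP.kernelDist n α hy) f (GASP.distOf hg.memWeightedL1)) ∧
    (∀ (f : GASP.Rn n → ℂ) (hf : GASP.MemWeightedL1 (α + n + 1) f) (y : ℝ) (hy : 0 < y),
        ∃ (g : GASP.Rn n → ℂ) (hg : GASP.MemWeightedL1 (α + n + 1) g),
          GASP.IsSConv (GASP.kernelDist n α hy) (GASP.distOf hf) (GASP.distOf hg)) := by
  refine ⟨fun f hf y hy => GASP.exists_isSConv_kernel hα hf hy, fun f hf y hy => ?_⟩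
  obtain ⟨g, hg, h⟩ := GASP.exists_isSConv_kernel hα (GASP.memWeightedDL1'_distOf hf) hy
  exact ⟨g, hg.memWeightedL1, h⟩
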